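/- Let $k$ be an algebraically closed field of characteristic $0$, let $\mathbf{F}$ be a finite field, and let $n,m\ge 0$ be integers. Let $\mathfrak{M}_{n,m}$ be the set of $n\times m$ matrices over $\mathbf{F}$, let $\mathfrak{M}_n=\mathfrak{M}_{n,n}$ be regarded as a monoid under multiplication, with monoid algebra $k[\mathfrak{M}_n]$, and let $\mathfrak{G}_r=\mathbf{GL}_r(\mathbf{F})$. Regard the $k$-vector space $k[\mathfrak{M}_{n,m}]$ with basis $\{[x] : x\in\mathfrak{M}_{n,m}\}$ as a left $(k[\mathfrak{M}_n]\otimes_k k[\mathfrak{M}_m])$-module via $$([a]\otimes[b])\cdot[x]=[a\,x\,b^{t}]\qquad(a\in\mathfrak{M}_n,\ b\in\mathfrak{M}_m).$$ For an irreducible representation $\pi$ of $\mathfrak{G}_r$ over $k$ on a space $V$, let $L_n(\pi)$ be the following left $k[\mathfrak{M}_n]$-module. For each $r$-dimensional subspace $U$ of $\mathbf{F}^n$ fix an isomorphism $f_U\colon\mathbf{F}^r\to U$. As a vector space, $L_n(\pi)=\bigoplus_U V u_U$ is a direct sum of copies $V u_U$ of $V$ indexed by the $r$-dimensional subspaces $U$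 of $\mathbf{F}^n$. The element $[a]$, $a\in\mathfrak{M}_n$, acts by $$[a]\cdot(v\,u_U)=\begin{cases}\big(\pi(f_{a(U)}^{-1}\circ a|_U\circ f_U)\,v\big)\,u_{a(U)} & \text{if }\dim a(U)=r,\\ 0 & \text{otherwise.}\end{cases}$$ (Up to isomorphism, this does not depend on the choice of the $f_U$.) Then there is an isomorphism of left $(k[\mathfrak{M}_n]\otimes_k k[\mathfrak{M}_m])$-modules $$k[\mathfrak{M}_{n,m}]\;\cong\;\bigoplus_{r=0}^{\min(n,m)}\ \bigoplus_{\pi} L_n(\pi)\otimes_k L_m(\pi),$$ where, for each $r$, $\pi$ runs over representatives of all isomorphism classes of irreducible representations of $\mathfrak{G}_r$ over $k$, each class occurring once. -/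

import Mathlib

open scoped TensorProduct DirectSum

noncomputable section

namespace MatrixMonoid

universe u v w

/-! ## Modules from algebra maps into endomorphism algebras -/

/-- The vector space `V`, regarded as a left `A`-module through an algebra homomorphism
`φ : A → End_k(V)`. -/
def ActionModule {k : Type u} {A : Type v} {V : Type w} [Field k] [Ring A] [Algebra k A]
    [AddCommGroup V] [Module k V] (_φ : A →ₐ[k] Module.End k V) : Type w := V

section ActionModule

variable {k : Type u} {A : Type v} {V : Type w} [Field k] [Ring A] [Algebra k A]
  [AddCommGroup V] [Module k V] (φ : A →ₐ[k] Module.End k V)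

instance ActionModule.instAddCommGroup : AddCommGroup (ActionModule φ) :=
  inferInstanceAs (AddCommGroup V)

/-- The element `a` of `A` acts on `V` as the operator `φ a`. -/
instance ActionModule.instModule : Module A (ActionModule φ) :=
  Module.compHom V (φ : A →+* Module.End k V)

/-- The identity map `V → ActionModule φ`. -/
def ActionModule.of : V ≃+ ActionModule φ := AddEquiv.refl V

theorem ActionModule.smul_of (a : A) (x : V) :
    a • ActionModule.of φ x = ActionModule.of φ (φ a x) := rfl

end ActionModule

/-- For representations `ρ` of the monoid `M` on `V` and `σ` of the monoid `N` on `W`, the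
algebra `k[M] ⊗ k[N]` acts on `V ⊗ W` by `(a ⊗ b)(x ⊗ y) = a x ⊗ b y`. -/
def boxAction {k : Type*} {M N V W : Type*} [Field k] [Monoid M] [Monoid N]
    [AddCommGroup V] [Module k V] [AddCommGroup W] [Module k W]
    (ρ : Representation k M V) (σ : Representation k N W) :
    (MonoidAlgebra k M ⊗[k] MonoidAlgebra k N) →ₐ[k] Module.End k (V ⊗[k] W) :=
  (Module.endTensorEndAlgHom (R := k) (A := k) (M := V) (N := W)).comp
    (Algebra.TensorProduct.map ρ.asAlgebraHom σ.asAlgebraHom)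

/-! ## Irreducible representations up to isomorphism -/

/-- An irreducible representation of `G` over `k`. -/
structure IrrRep (k : Type u) (G : Type v) [Field k] [Group G] where
  /-- the underlying vector space -/
  V : Type u
  [addCommGroup : AddCommGroup V]
  [module : Module k V]
  /-- the action -/
  ρ : Representation k G V
  irreducible : ρ.IsIrreducible

attribute [instance] IrrRep.addCommGroup IrrRep.module

/-- Isomorphism of irreducible representations. -/
instance IrrRep.setoid (k : Type u) (G : Type v) [Field k] [Group G] : Setoid (IrrRep k G) where
  r π π' := Nonempty (π.ρ.Equiv π'.ρ)
  iseqv :=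
    { refl := fun _ => ⟨Representation.Equiv.refl _⟩
      symm := fun ⟨e⟩ => ⟨e.symm⟩
      trans := fun ⟨e⟩ ⟨e'⟩ => ⟨e.trans e'⟩ }

/-- The set of isomorphism classes of irreducible representations of `G` over `k`. -/
def IrrClass (k : Type u) (G : Type v) [Field k] [Group G] : Type (max (u + 1) v) :=
  Quotient (IrrRep.setoid k G)

/-- The isomorphism class of an irreducible representation. -/
def IrrRep.toClass {k : Type u} {G : Type v} [Field k] [Group G] (π : IrrRep k G) :
    IrrClass k G := Quotient.mk _ π

/-! ## The modules `L_n(π)` -/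

section Simple

variable {k : Type u} {F : Type v} [Field k] [Field F]

/-- The `r`-dimensional subspaces of `F^n`. -/
@[ext]
structure Grass (F : Type v) [Field F] (n r : ℕ) where
  /-- the underlying subspace -/
  space : Submodule F (Fin n → F)
  finrank_eq : Module.finrank F space = r

/-- A fixed isomorphism `f_U : F^r → U`, for each `r`-dimensional subspace `U` of `F^n`. -/
def Grass.frame {n r : ℕ} (U : Grass F n r) : (Fin r → F) ≃ₗ[F] U.space :=
  LinearEquiv.ofFinrankEq _ _ (by rw [Module.finrank_fin_fun, U.finrank_eq])

/-- The image `a(U)` of a subspace `U` under a matrix `a`. -/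
def imageOf {n : ℕ} (a : Matrix (Fin n) (Fin n) F) (U : Submodule F (Fin n → F)) :
    Submodule F (Fin n → F) := U.map (Matrix.toLin' a)

theorem imageOf_one {n : ℕ} (U : Submodule F (Fin n → F)) :
    imageOf (1 : Matrix (Fin n) (Fin n) F) U = U := by
  simp [imageOf]

theorem imageOf_mul {n : ℕ} (a b : Matrix (Fin n) (Fin n) F) (U : Submodule F (Fin n → F)) :
    imageOf (a * b) U = imageOf a (imageOf b U) := by
  simp [imageOf, Matrix.toLin'_mul, Submodule.map_comp]

theorem finrank_imageOf_le {n : ℕ} (a : Matrix (Fin n) (Fin n) F)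
    (U : Submodule F (Fin n → F)) :
    Module.finrank F (imageOf a U) ≤ Module.finrank F U :=
  Submodule.finrank_map_le _ _

/-- The restriction `a|_U : U → a(U)`, an isomorphism when `dim a(U) = dim U`. -/
def restrictEquiv {n : ℕ} (a : Matrix (Fin n) (Fin n) F) (U : Submodule F (Fin n → F))
    (h : Module.finrank F (imageOf a U) = Module.finrank F U) : U ≃ₗ[F] imageOf a U :=
  LinearEquiv.ofBijective ((Matrix.toLin' a).submoduleMap U)
    ⟨(LinearMap.injective_iff_surjective_of_finrank_eq_finrank h.symm).2
      ((Matrix.toLin' a).submoduleMap_surjective U), (Matrix.toLin' a).submoduleMap_surjective U⟩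

/-- The element `f_{a(U)}⁻¹ ∘ a|_U ∘ f_U` of `GL_r(F)`, for an `r`-dimensional subspace `U` such
that `a(U)` is `r`-dimensional too. -/
def transition {n r : ℕ} (a : Matrix (Fin n) (Fin n) F) (U : Grass F n r)
    (h : Module.finrank F (imageOf a U.space) = r) : GL (Fin r) F :=
  Matrix.GeneralLinearGroup.toLin.symm
    ((LinearMap.GeneralLinearGroup.generalLinearEquiv F (Fin r → F)).symm
      (U.frame ≪≫ₗ restrictEquiv a U.space (h.trans U.finrank_eq.symm) ≪≫ₗ
        (Grass.frame (⟨imageOf a U.space, h⟩ : Grass F n r)).symm))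

theorem frame_congr {n r : ℕ} {U U' : Grass F n r} (h : U = U') (x : Fin r → F) :
    (U.frame x : Fin n → F) = U'.frame x := by subst h; rfl

theorem toLin'_transition {n r : ℕ} (a : Matrix (Fin n) (Fin n) F) (U : Grass F n r)
    (h : Module.finrank F (imageOf a U.space) = r) (x : Fin r → F) :
    (Grass.frame (⟨imageOf a U.space, h⟩ : Grass F n r)
      (Matrix.toLin' (transition a U h : Matrix (Fin r) (Fin r) F) x) : Fin n → F)
      = Matrix.toLin' a (U.frame x) := by
  have : Matrix.toLin' (transition a U h : Matrix (Fin r) (Fin r) F) x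
      = (U.frame ≪≫ₗ restrictEquiv a U.space (h.trans U.finrank_eq.symm) ≪≫ₗ
        (Grass.frame (⟨imageOf a U.space, h⟩ : Grass F n r)).symm) x := by
    have h2 := MulEquiv.apply_symm_apply (Matrix.GeneralLinearGroup.toLin (n := Fin r) (R := F))
      ((LinearMap.GeneralLinearGroup.generalLinearEquiv F (Fin r → F)).symm
        (U.frame ≪≫ₗ restrictEquiv a U.space (h.trans U.finrank_eq.symm) ≪≫ₗ
          (Grass.frame (⟨imageOf a U.space, h⟩ : Grass F n r)).symm))
    have h3 := congrArg (fun g : LinearMap.GeneralLinearGroup F (Fin r → F) =>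
      (g : (Fin r → F) →ₗ[F] (Fin r → F)) x) h2
    exact h3
  rw [this, LinearEquiv.trans_apply, LinearEquiv.trans_apply, LinearEquiv.apply_symm_apply]
  rfl

theorem transition_unique {n r : ℕ} (a : Matrix (Fin n) (Fin n) F) (U : Grass F n r)
    (h : Module.finrank F (imageOf a U.space) = r) (g : GL (Fin r) F)
    (hg : ∀ x, (Grass.frame (⟨imageOf a U.space, h⟩ : Grass F n r)
      (Matrix.toLin' (g : Matrix (Fin r) (Fin r) F) x) : Fin n → F)
      = Matrix.toLin' a (U.frame x)) : transition a U h = g := by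
  apply Units.ext
  apply Matrix.toLin'.injective
  ext1 x
  ext1
  simp only [LinearMap.comp_apply]
  apply (Grass.frame (⟨imageOf a U.space, h⟩ : Grass F n r)).injective
  apply Subtype.ext
  rw [hg, toLin'_transition]

theorem transition_one {n r : ℕ} (U : Grass F n r)
    (h : Module.finrank F (imageOf (1 : Matrix (Fin n) (Fin n) F) U.space) = r) :
    transition 1 U h = 1 := by
  apply transition_unique
  intro x
  simp only [Units.val_one, Matrix.toLin'_one, LinearMap.id_apply]
  exact frame_congr (Grass.ext (imageOf_one U.space)) x

theorem transition_mul {n r : ℕ} (a b : Matrix (Fin n) (Fin n) F) (U : Grass F n r)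
    (h : Module.finrank F (imageOf (a * b) U.space) = r)
    (hb : Module.finrank F (imageOf b U.space) = r)
    (ha : Module.finrank F (imageOf a (imageOf b U.space)) = r) :
    transition (a * b) U h = transition a ⟨imageOf b U.space, hb⟩ ha * transition b U hb := by
  apply transition_unique
  intro x
  rw [frame_congr (U' := ⟨imageOf a (imageOf b U.space), ha⟩) (Grass.ext (imageOf_mul a b U.space)),
    Units.val_mul, Matrix.toLin'_mul, LinearMap.comp_apply]
  have := toLin'_transition a ⟨imageOf b U.space, hb⟩ ha
    (Matrix.toLin' (transition b U hb : Matrix (Fin r) (Fin r) F) x)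
  rw [this, toLin'_transition, Matrix.toLin'_mul, LinearMap.comp_apply]

variable {V : Type w} [AddCommGroup V] [Module k V]

open Classical in
/-- The operator by which the matrix `a` acts on `L_n(ρ) = ⨁_U V`: it carries the copy of `V`
at `U` to the copy of `V` at `a(U)` by `ρ (f_{a(U)}⁻¹ ∘ a|_U ∘ f_U)` if `dim a(U) = r`, and it
kills the copy of `V` at `U` otherwise. -/
def simpleOp {r : ℕ} (n : ℕ) (ρ : Representation k (GL (Fin r) F) V)
    (a : Matrix (Fin n) (Fin n) F) : Module.End k (Grass F n r →₀ V) :=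
  Finsupp.lsum k fun U : Grass F n r =>
    if h : Module.finrank F (imageOf a U.space) = r then
      Finsupp.lsingle (⟨imageOf a U.space, h⟩ : Grass F n r) ∘ₗ ρ (transition a U h)
    else 0

theorem simpleOp_single {r : ℕ} (n : ℕ) (ρ : Representation k (GL (Fin r) F) V)
    (a : Matrix (Fin n) (Fin n) F) (U : Grass F n r)
    (h : Module.finrank F (imageOf a U.space) = r) (x : V) :
    simpleOp n ρ a (Finsupp.single U x)
      = Finsupp.single (⟨imageOf a U.space, h⟩ : Grass F n r) (ρ (transition a U h) x) := by
  rw [simpleOp, Finsupp.lsum_single, dif_pos h]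
  rfl

theorem simpleOp_single_of_ne {r : ℕ} (n : ℕ) (ρ : Representation k (GL (Fin r) F) V)
    (a : Matrix (Fin n) (Fin n) F) (U : Grass F n r)
    (h : Module.finrank F (imageOf a U.space) ≠ r) (x : V) :
    simpleOp n ρ a (Finsupp.single U x) = 0 := by
  simp [simpleOp, h]

/-- The module `L_n(ρ)` attached to a representation `ρ` of `GL_r(F)` on `V`, as a representation
of the monoid of `n × n` matrices. Its space `V ⊗ k^N`, where `N` is the number of
`r`-dimensional subspaces of `F^n`, is written as a direct sum of copies of `V` indexed by these
subspaces. -/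
def simpleRep {r : ℕ} (n : ℕ) (ρ : Representation k (GL (Fin r) F) V) :
    Representation k (Matrix (Fin n) (Fin n) F) (Grass F n r →₀ V) where
  toFun := simpleOp n ρ
  map_one' := by
    ext1 U
    ext1 x
    have h : Module.finrank F (imageOf (1 : Matrix (Fin n) (Fin n) F) U.space) = r := by
      rw [imageOf_one, U.finrank_eq]
    simp only [LinearMap.comp_apply, Finsupp.lsingle_apply]
    rw [simpleOp_single n ρ 1 U h, transition_one, map_one]
    have hU : (⟨imageOf 1 U.space, h⟩ : Grass F n r) = U := Grass.ext (imageOf_one U.space)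
    rw [hU]
    rfl
  map_mul' a b := by
    ext1 U
    ext1 x
    simp only [LinearMap.comp_apply, Finsupp.lsingle_apply, Module.End.mul_apply]
    by_cases hb : Module.finrank F (imageOf b U.space) = r
    · rw [simpleOp_single n ρ b U hb]
      by_cases ha : Module.finrank F (imageOf a (imageOf b U.space)) = r
      · have h : Module.finrank F (imageOf (a * b) U.space) = r := by rw [imageOf_mul, ha]
        rw [simpleOp_single n ρ _ U h, simpleOp_single n ρ a ⟨imageOf b U.space, hb⟩ ha,
          transition_mul a b U h hb ha, map_mul]
        have hU : (⟨imageOf (a * b) U.space, h⟩ : Grass F n r)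
            = ⟨imageOf a (imageOf b U.space), ha⟩ := Grass.ext (imageOf_mul a b U.space)
        rw [hU]
        rfl
      · rw [simpleOp_single_of_ne n ρ a ⟨imageOf b U.space, hb⟩ ha, simpleOp_single_of_ne]
        rwa [imageOf_mul]
    · rw [simpleOp_single_of_ne n ρ b U hb, map_zero, simpleOp_single_of_ne]
      rw [imageOf_mul]
      have h1 := finrank_imageOf_le a (imageOf b U.space)
      have h2 := finrank_imageOf_le b U.space
      have h3 := U.finrank_eq
      omega

end Simple

/-! ## The module `k[M_{n,m}]` -/

section Rect

variable (k : Type u) (F : Type v) [Field k] [Field F] (n m : ℕ)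

/-- The action of `n × n` matrices on `k[M_{n,m}]` by left multiplication, `a [x] = [a x]`. -/
def leftRep : Representation k (Matrix (Fin n) (Fin n) F) (Matrix (Fin n) (Fin m) F →₀ k) where
  toFun a := Finsupp.lmapDomain k k fun x => a * x
  map_one' := by ext; simp
  map_mul' a b := by ext; simp [Matrix.mul_assoc]

/-- The action of `m × m` matrices on `k[M_{n,m}]` by right multiplication, turned into a left
action by transposition, `b [x] = [x bᵀ]`. -/
def rightRep : Representation k (Matrix (Fin m) (Fin m) F) (Matrix (Fin n) (Fin m) F →₀ k) where
  toFun b := Finsupp.lmapDomain k k fun x => x * b.transpose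
  map_one' := by ext; simp
  map_mul' a b := by ext; simp [Matrix.mul_assoc]

theorem leftRep_commute_rightRep (a : Matrix (Fin n) (Fin n) F) (b : Matrix (Fin m) (Fin m) F) :
    Commute (leftRep k F n m a) (rightRep k F n m b) := by
  rw [commute_iff_eq]
  ext
  simp [leftRep, rightRep, Matrix.mul_assoc]

theorem leftAlg_commute_rightAlg (a : MonoidAlgebra k (Matrix (Fin n) (Fin n) F))
    (b : MonoidAlgebra k (Matrix (Fin m) (Fin m) F)) :
    Commute ((leftRep k F n m).asAlgebraHom a) ((rightRep k F n m).asAlgebraHom b) := by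
  induction a using MonoidAlgebra.induction_on with
  | of a =>
    induction b using MonoidAlgebra.induction_on with
    | of b =>
      simpa [Representation.asAlgebraHom_of] using leftRep_commute_rightRep k F n m a b
    | add x y hx hy => rw [map_add]; exact hx.add_right hy
    | smul c x hx => rw [map_smul]; exact hx.smul_right c
  | add x y hx hy => rw [map_add]; exact hx.add_left hy
  | smul c x hx => rw [map_smul]; exact hx.smul_left c

/-- The action of `k[M_n] ⊗ k[M_m]` on `k[M_{n,m}]`, given by `(a ⊗ b) [x] = [a x bᵀ]`. -/
def rectAction :
    (MonoidAlgebra k (Matrix (Fin n) (Fin n) F) ⊗[k] MonoidAlgebra k (Matrix (Fin m) (Fin m) F))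
      →ₐ[k] Module.End k (Matrix (Fin n) (Fin m) F →₀ k) :=
  Algebra.TensorProduct.lift (leftRep k F n m).asAlgebraHom (rightRep k F n m).asAlgebraHom
    (leftAlg_commute_rightAlg k F n m)

end Rect

end MatrixMonoid

end

/-! Filter `k[M_{n,m}]` by rank. A matrix of rank `r` is the same thing as a triple (column space
`U`, row space `W`, element of `GL_r(F)`), so the `r`-th layer is a sum over pairs `(U, W)` of
copies of the functions on `GL_r(F)`. By Peter–Weyl these functions are spanned, without redundancy,
by the matrix coefficients of the irreducible `π`, so each copy is a sum of spaces `π ⊗ π*`.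

The second factor becomes `π` rather than its dual because the right action is twisted by
transposition. Every square matrix is similar to its transpose, so the dual of `π` twisted by
transposition has the character of `π`, hence is isomorphic to it (`exists_selfDual`, from
`exists_mul_eq_transpose_mul`). Placing coefficients at the pairs `(U, W)` then gives a map from
`L_n(π) ⊗ L_m(π)` which is equivariant modulo lower rank (`layerMap_equivariant`): the matrices that
shrink `U` or `W` are those that act by zero on the corresponding summand.

The filtration splits by Kovács' theorem (`exists_left_identity`): the ideal of `k[M_n]` spanned by
the matrices of rank less than `r` has an identity `η_r`, central in `k[M_n]`, which also fixes the
`n × m` matrices of rank less than `r`, for every `m`. Multiplication by `1 - η_r` kills the error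
terms, so it turns the map on the layer into an equivariant embedding and changes it only in lower
rank. The sum of these embeddings is injective because `η_{r+1}` kills the summands of rank above
`r`, while coefficients at matrices of rank `r` ignore those below (`conv_totalMap_apply`). It is
surjective by induction on the rank. -/

noncomputable section

namespace MatrixMonoid

universe u v

/-! ## Convolution of matrices -/

section Conv

variable {k F : Type*} [Field k] [Field F] {n m p q : ℕ}

/-- The bilinear extension `[x] ⬝ [y] = [x y]` of matrix multiplication. -/
def conv : (Matrix (Fin n) (Fin p) F →₀ k) →ₗ[k] (Matrix (Fin p) (Fin m) F →₀ k) →ₗ[k]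
    (Matrix (Fin n) (Fin m) F →₀ k) :=
  Finsupp.lsum k fun x => (LinearMap.id (R := k)).smulRight (Finsupp.lmapDomain k k fun y => x * y)

theorem conv_single_single (x : Matrix (Fin n) (Fin p) F) (y : Matrix (Fin p) (Fin m) F)
    (a b : k) : conv (Finsupp.single x a) (Finsupp.single y b) = Finsupp.single (x * y) (a * b) := by
  simp [conv]

theorem conv_assoc (u : Matrix (Fin n) (Fin p) F →₀ k) (v : Matrix (Fin p) (Fin q) F →₀ k)
    (w : Matrix (Fin q) (Fin m) F →₀ k) : conv (conv u v) w = conv u (conv v w) := by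
  induction u using Finsupp.induction_linear with
  | zero => simp
  | add f g hf hg => simp [hf, hg]
  | single x a =>
    induction v using Finsupp.induction_linear with
    | zero => simp
    | add f g hf hg => simp [hf, hg]
    | single y b =>
      induction w using Finsupp.induction_linear with
      | zero => simp
      | add f g hf hg => simp [hf, hg]
      | single z c => simp only [conv_single_single, Matrix.mul_assoc, mul_assoc]

theorem single_one_conv (u : Matrix (Fin n) (Fin m) F →₀ k) :
    conv (Finsupp.single 1 1) u = u := by
  induction u using Finsupp.induction_linear with
  | zero => simp
  | add f g hf hg => simp [hf, hg]
  | single x a => simp [conv_single_single]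

theorem leftRep_apply (a : Matrix (Fin n) (Fin n) F) (u : Matrix (Fin n) (Fin m) F →₀ k) :
    leftRep k F n m a u = conv (Finsupp.single a 1) u := by
  induction u using Finsupp.induction_linear with
  | zero => simp
  | add f g hf hg => simp [hf, hg]
  | single x c => simp [conv_single_single, leftRep]

theorem rightRep_apply (b : Matrix (Fin m) (Fin m) F) (u : Matrix (Fin n) (Fin m) F →₀ k) :
    rightRep k F n m b u = conv u (Finsupp.single b.transpose 1) := by
  induction u using Finsupp.induction_linear with
  | zero => simp
  | add f g hf hg => simp [hf, hg]
  | single x c => simp [conv_single_single, rightRep]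

/-- The linear extension of matrix transposition. -/
def transposeHom {F : Type*} {n m : ℕ} :
    (Matrix (Fin n) (Fin m) F →₀ k) →ₗ[k] (Matrix (Fin m) (Fin n) F →₀ k) :=
  Finsupp.lmapDomain k k Matrix.transpose

theorem transposeHom_single {F : Type*} (x : Matrix (Fin n) (Fin m) F) (a : k) :
    transposeHom (Finsupp.single x a) = Finsupp.single x.transpose a := by
  simp [transposeHom]

theorem transposeHom_transposeHom {F : Type*} {n m : ℕ} (u : Matrix (Fin n) (Fin m) F →₀ k) :
    transposeHom (transposeHom u) = u := by
  induction u using Finsupp.induction_linear with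
  | zero => simp
  | add f g hf hg => simp [hf, hg]
  | single x a => simp [transposeHom_single]

theorem transposeHom_conv (u : Matrix (Fin n) (Fin p) F →₀ k) (v : Matrix (Fin p) (Fin m) F →₀ k) :
    transposeHom (conv u v) = conv (transposeHom v) (transposeHom u) := by
  induction u using Finsupp.induction_linear with
  | zero => simp
  | add f g hf hg => simp [hf, hg]
  | single x a =>
    induction v using Finsupp.induction_linear with
    | zero => simp
    | add f g hf hg => simp [hf, hg]
    | single y b =>
      simp only [conv_single_single, transposeHom_single, Matrix.transpose_mul, mul_comm a b]

variable (k F n m) in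
/-- The span of the matrices of rank less than `r`. -/
def lowRank (r : ℕ) : Submodule k (Matrix (Fin n) (Fin m) F →₀ k) :=
  Finsupp.supported k k {x | x.rank < r}

theorem single_mem_lowRank {r : ℕ} {x : Matrix (Fin n) (Fin m) F} (h : x.rank < r) (a : k) :
    Finsupp.single x a ∈ lowRank k F n m r :=
  Finsupp.single_mem_supported k a h

theorem lowRank_mono {r s : ℕ} (h : r ≤ s) : lowRank k F n m r ≤ lowRank k F n m s :=
  Finsupp.supported_mono fun _ hx => lt_of_lt_of_le hx h

@[elab_as_elim]
theorem lowRank_induction {r : ℕ}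
    {motive : ∀ u : Matrix (Fin n) (Fin m) F →₀ k, u ∈ lowRank k F n m r → Prop}
    (zero : motive 0 (zero_mem _))
    (add : ∀ u v hu hv, motive u hu → motive v hv → motive (u + v) (add_mem hu hv))
    (single : ∀ (x : Matrix (Fin n) (Fin m) F) (a : k) (hx : x.rank < r),
      motive (Finsupp.single x a) (single_mem_lowRank hx a))
    {u : Matrix (Fin n) (Fin m) F →₀ k} (hu : u ∈ lowRank k F n m r) : motive u hu := by
  have : ∀ x ∈ u.support, ∃ h, motive (Finsupp.single x (u x)) h :=
    fun x hx => ⟨_, single x _ (hu hx)⟩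
  suffices ∃ h, motive u h from this.2
  have key := Finset.sum_induction (fun x => Finsupp.single x (u x)) (fun v => ∃ h, motive v h)
    (fun _ _ ⟨_, h⟩ ⟨_, h'⟩ => ⟨_, add _ _ _ _ h h'⟩) ⟨_, zero⟩ this
  rwa [show ∑ x ∈ u.support, Finsupp.single x (u x) = u from Finsupp.sum_single u] at key

theorem conv_mem_lowRank_left {r : ℕ} {u : Matrix (Fin n) (Fin p) F →₀ k}
    (hu : u ∈ lowRank k F n p r) (v : Matrix (Fin p) (Fin m) F →₀ k) :
    conv u v ∈ lowRank k F n m r := by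
  induction hu using lowRank_induction with
  | zero => simp
  | add u v _ _ hu hv => simpa using add_mem hu hv
  | single x a hx =>
    induction v using Finsupp.induction_linear with
    | zero => simp
    | add f g hf hg => simpa using add_mem hf hg
    | single y b =>
      rw [conv_single_single]
      exact single_mem_lowRank ((Matrix.rank_mul_le_left x y).trans_lt hx) _

theorem conv_mem_lowRank_right {r : ℕ} (u : Matrix (Fin n) (Fin p) F →₀ k)
    {v : Matrix (Fin p) (Fin m) F →₀ k} (hv : v ∈ lowRank k F p m r) :
    conv u v ∈ lowRank k F n m r := by
  induction hv using lowRank_induction with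
  | zero => simp
  | add u v _ _ hu hv => simpa using add_mem hu hv
  | single x a hx =>
    induction u using Finsupp.induction_linear with
    | zero => simp
    | add f g hf hg => simpa using add_mem hf hg
    | single y b =>
      rw [conv_single_single]
      exact single_mem_lowRank ((Matrix.rank_mul_le_right y x).trans_lt hx) _

theorem transposeHom_mem_lowRank {r : ℕ} {u : Matrix (Fin n) (Fin m) F →₀ k}
    (hu : u ∈ lowRank k F n m r) : transposeHom u ∈ lowRank k F m n r := by
  induction hu using lowRank_induction with
  | zero => simp
  | add u v _ _ hu hv => simpa using add_mem hu hv
  | single x a hx =>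
    rw [transposeHom_single]
    exact single_mem_lowRank (by rwa [Matrix.rank_transpose]) _

theorem apply_eq_zero_of_mem_lowRank {u : Matrix (Fin n) (Fin m) F →₀ k}
    (hu : u ∈ lowRank k F n m r) {x : Matrix (Fin n) (Fin m) F} (hx : r ≤ x.rank) : u x = 0 := by
  by_contra h
  exact absurd (hu (Finsupp.mem_support_iff.2 h)) (not_lt.2 hx)

theorem lowRank_eq_top {r : ℕ} (h : min n m < r) : lowRank k F n m r = ⊤ := by
  rw [eq_top_iff]
  rintro u -
  refine fun x _ => ?_
  have h1 := x.rank_le_width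
  have h2 := x.rank_le_height
  simp only [Set.mem_ofPred_eq]
  omega

/-- A left identity modulo transposition of the span of the matrices of rank less than `r` is
central: it is a two-sided identity of a two-sided ideal. -/
theorem conv_comm_of_left_identity {r : ℕ} {η : Matrix (Fin n) (Fin n) F →₀ k}
    (hη : η ∈ lowRank k F n n r)
    (hid : ∀ y : Matrix (Fin n) (Fin n) F, y.rank < r →
      conv η (Finsupp.single y 1) = Finsupp.single y (1 : k))
    (a : Matrix (Fin n) (Fin n) F) :
    conv (Finsupp.single a 1) η = conv η (Finsupp.single a 1) := by
  have hl : ∀ u ∈ lowRank k F n n r, conv η u = u := by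
    intro u hu
    induction hu using lowRank_induction with
    | zero => simp
    | add u v _ _ hu hv => simp [hu, hv]
    | single x a hx =>
      rw [← mul_one a, ← smul_eq_mul, ← Finsupp.smul_single, map_smul, hid x hx]
  have hr : ∀ u ∈ lowRank k F n n r, conv u (transposeHom η) = u := by
    intro u hu
    rw [← transposeHom_transposeHom u, ← transposeHom_conv, hl _ (transposeHom_mem_lowRank hu)]
  -- A left and a right identity of the same ideal coincide: both equal the product of `η` with its
  -- transpose.
  have ht : transposeHom η = η := by
    rw [← hl _ (transposeHom_mem_lowRank hη), hr _ hη]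
  rw [ht] at hr
  rw [← hr _ (conv_mem_lowRank_left hη (Finsupp.single a 1)), conv_assoc,
    hl _ (conv_mem_lowRank_right _ hη)]

end Conv

/-! ## Matrices of frames -/

section Frame

variable {F : Type*} [Field F] {n m r : ℕ}

/-- The matrix whose columns are the images of the standard basis under the frame of `U`. -/
def Grass.matrix (U : Grass F n r) : Matrix (Fin n) (Fin r) F :=
  LinearMap.toMatrix' (U.space.subtype ∘ₗ U.frame.toLinearMap)

theorem Grass.toLin'_matrix (U : Grass F n r) (x : Fin r → F) :
    Matrix.toLin' U.matrix x = U.frame x := by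
  simp [Grass.matrix]

theorem Grass.range_toLin'_matrix (U : Grass F n r) :
    LinearMap.range (Matrix.toLin' U.matrix) = U.space := by
  rw [Grass.matrix, Matrix.toLin'_toMatrix', LinearMap.range_comp, LinearEquiv.range]
  simp

theorem Grass.exists_left_inverse (U : Grass F n r) :
    ∃ p : Matrix (Fin r) (Fin n) F, p * U.matrix = 1 := by
  obtain ⟨g, hg⟩ := (Matrix.toLin' U.matrix).exists_leftInverse_of_injective (by
    rw [LinearMap.ker_eq_bot]
    intro x y h
    rw [U.toLin'_matrix, U.toLin'_matrix] at h
    exact U.frame.injective (Subtype.ext h))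
  refine ⟨LinearMap.toMatrix' g, Matrix.toLin'.injective ?_⟩
  rw [Matrix.toLin'_mul, Matrix.toLin'_toMatrix', hg, Matrix.toLin'_one]

/-- A left inverse of the matrix of the frame of `U`. -/
def Grass.retract (U : Grass F n r) : Matrix (Fin r) (Fin n) F := U.exists_left_inverse.choose

theorem Grass.retract_mul_matrix (U : Grass F n r) : U.retract * U.matrix = 1 :=
  U.exists_left_inverse.choose_spec

/-- The column space of a matrix of rank `r`. -/
def columnSpace (y : Matrix (Fin n) (Fin m) F) (h : y.rank = r) : Grass F n r :=
  ⟨LinearMap.range (Matrix.toLin' y), h⟩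

theorem Grass.exists_eq_matrix_mul (U : Grass F n r) (y : Matrix (Fin n) (Fin m) F)
    (h : LinearMap.range (Matrix.toLin' y) ≤ U.space) :
    ∃ g : Matrix (Fin r) (Fin m) F, y = U.matrix * g := by
  refine ⟨LinearMap.toMatrix' (U.frame.symm.toLinearMap ∘ₗ
    (Matrix.toLin' y).codRestrict U.space fun x => h ⟨x, rfl⟩), ?_⟩
  apply Matrix.toLin'.injective
  ext1 j
  ext1
  simp only [LinearMap.comp_apply, Matrix.toLin'_mul, U.toLin'_matrix, Matrix.toLin'_toMatrix',
    LinearEquiv.coe_coe, LinearEquiv.apply_symm_apply, LinearMap.codRestrict_apply]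

theorem Grass.eq_columnSpace (U : Grass F n r) (y : Matrix (Fin n) (Fin m) F) (h : y.rank = r)
    (hy : y = U.matrix * (U.retract * y)) : U = columnSpace y h := by
  apply Grass.ext
  symm
  apply Submodule.eq_of_le_of_finrank_eq
  · change LinearMap.range (Matrix.toLin' y) ≤ _
    rw [hy, Matrix.toLin'_mul, ← U.range_toLin'_matrix]
    exact LinearMap.range_comp_le_range _ _
  · exact h.trans U.finrank_eq.symm

theorem columnSpace_factor (y : Matrix (Fin n) (Fin m) F) (h : y.rank = r) :
    y = (columnSpace y h).matrix * ((columnSpace y h).retract * y) := by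
  obtain ⟨g, hg⟩ := (columnSpace y h).exists_eq_matrix_mul y le_rfl
  generalize hU : columnSpace y h = U at hg ⊢
  rw [hg, ← Matrix.mul_assoc U.retract, U.retract_mul_matrix, Matrix.one_mul]

instance [Finite F] : Finite (Grass F n r) :=
  Finite.of_injective Grass.space fun _ _ => Grass.ext

end Frame

/-! ## Identity elements of the ideals spanned by the matrices of small rank -/

section Kovacs

variable {k F : Type*} [Field k] [Field F] {n m r : ℕ}

open Classical in
/-- The average of `[f (A p + b)]` over the `b` with `b f = 0`, where `f` is the matrix of the
frame of `U` and `p` is its left inverse, extended linearly in `[A]`. -/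
def Grass.avg [Fintype F] (U : Grass F n r) :
    (Matrix (Fin r) (Fin r) F →₀ k) →ₗ[k] (Matrix (Fin n) (Fin n) F →₀ k) :=
  ((Fintype.card {b : Matrix (Fin r) (Fin n) F // b * U.matrix = 0} : k)⁻¹) •
    ∑ b : {b : Matrix (Fin r) (Fin n) F // b * U.matrix = 0},
      Finsupp.lmapDomain k k fun A => U.matrix * (A * U.retract + b.1)

theorem Grass.avg_mem_lowRank [Fintype F] (U : Grass F n r) (c : Matrix (Fin r) (Fin r) F →₀ k) :
    U.avg c ∈ lowRank k F n n (r + 1) := by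
  classical
  induction c using Finsupp.induction_linear with
  | zero => simp
  | add f g hf hg => simpa using add_mem hf hg
  | single A a =>
    rw [Grass.avg, LinearMap.smul_apply, LinearMap.sum_apply]
    refine Submodule.smul_mem _ _ (Submodule.sum_mem _ fun b _ => ?_)
    rw [Finsupp.lmapDomain_apply, Finsupp.mapDomain_single]
    refine single_mem_lowRank (Nat.lt_succ_of_le ((Matrix.rank_mul_le_left _ _).trans ?_)) _
    exact Matrix.rank_le_width _

/-- Since `p f = 1` and `b f = 0`, the product `f (A p + b) f g` equals `f A g` for every `b`. All
the terms of the average agree. -/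
theorem Grass.avg_conv_matrix_mul [CharZero k] [Fintype F] (U : Grass F n r)
    (c : Matrix (Fin r) (Fin r) F →₀ k) (g : Matrix (Fin r) (Fin m) F) :
    conv (U.avg c) (Finsupp.single (U.matrix * g) 1)
      = conv (Finsupp.single U.matrix 1) (conv c (Finsupp.single g (1 : k))) := by
  classical
  induction c using Finsupp.induction_linear with
  | zero => simp
  | add f g hf hg => simp [hf, hg]
  | single A a =>
    rw [Grass.avg, LinearMap.smul_apply, LinearMap.sum_apply, map_smul, LinearMap.smul_apply,
      map_sum, LinearMap.sum_apply]
    have : ∀ b : {b : Matrix (Fin r) (Fin n) F // b * U.matrix = 0},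
        conv (Finsupp.lmapDomain k k (fun A => U.matrix * (A * U.retract + b.1))
          (Finsupp.single A a)) (Finsupp.single (U.matrix * g) 1)
        = Finsupp.single (U.matrix * (A * g)) a := by
      intro b
      rw [Finsupp.lmapDomain_apply, Finsupp.mapDomain_single, conv_single_single, mul_one]
      congr 1
      rw [Matrix.mul_assoc, ← Matrix.mul_assoc _ U.matrix g, Matrix.add_mul, Matrix.mul_assoc A,
        U.retract_mul_matrix, b.2, Matrix.mul_one, add_zero]
    rw [Finset.sum_congr rfl fun b _ => this b, Finset.sum_const, Finset.card_univ,
      ← Nat.cast_smul_eq_nsmul k, smul_smul, inv_mul_cancel₀, one_smul, conv_single_single,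
      conv_single_single, mul_one, one_mul]
    have : Nonempty {b : Matrix (Fin r) (Fin n) F // b * U.matrix = 0} := ⟨⟨0, by simp⟩⟩
    exact Nat.cast_ne_zero.2 Fintype.card_ne_zero

/-- When the columns of `y` do not all lie in `U`, the averaging over `b` absorbs part of `A p y`: a
translation of `b`, uniform in `b` but depending on `A`, replaces `p y` by a matrix `p y t` of rank
less than `r`, and `c` annihilates such matrices. -/
theorem Grass.avg_conv_eq_zero [Fintype F] (U : Grass F n r) (c : Matrix (Fin r) (Fin r) F →₀ k)
    (hc : ∀ g : Matrix (Fin r) (Fin m) F, g.rank < r → conv c (Finsupp.single g (1 : k)) = 0)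
    (y : Matrix (Fin n) (Fin m) F) (hr : y.rank ≤ r) (hy : y ≠ U.matrix * (U.retract * y)) :
    conv (U.avg c) (Finsupp.single y 1) = 0 := by
  classical
  set d : Matrix (Fin n) (Fin n) F := 1 - U.matrix * U.retract with hd
  have hdy : d * y ≠ 0 := by
    rw [hd, Matrix.sub_mul, Matrix.one_mul, Matrix.mul_assoc]
    exact sub_ne_zero.2 hy
  have hdU : d * U.matrix = 0 := by
    rw [hd, Matrix.sub_mul, Matrix.one_mul, Matrix.mul_assoc, U.retract_mul_matrix,
      Matrix.mul_one, sub_self]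
  obtain ⟨i, j, hij⟩ : ∃ i j, (d * y) i j ≠ 0 := by
    by_contra! h
    exact hdy (Matrix.ext h)
  -- the functional `β` vanishes on `U` and is `1` at the `j`-th column of `y`
  set β : Matrix (Fin 1) (Fin n) F := Matrix.single 0 i ((d * y) i j)⁻¹ * d with hβ
  set v : Matrix (Fin m) (Fin 1) F := Matrix.single j 0 1 with hv
  have hβU : β * U.matrix = 0 := by rw [hβ, Matrix.mul_assoc, hdU, Matrix.mul_zero]
  have hβyv : β * (y * v) = 1 := by
    rw [hβ, Matrix.mul_assoc, ← Matrix.mul_assoc d, ← Matrix.mul_assoc, hv,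
      Matrix.single_mul_mul_single, inv_mul_cancel₀ hij, one_mul]
    ext a b
    rw [Subsingleton.elim a 0, Subsingleton.elim b 0, Matrix.single_apply_same,
      Matrix.one_apply_eq]
  -- Right multiplication by `t` projects the column space of `y` into the kernel of `β`. The column
  -- `y v` is outside this kernel, so the rank drops.
  set t : Matrix (Fin m) (Fin m) F := 1 - v * (β * y) with ht
  have hyt : (U.retract * (y * t)).rank < r := by
    refine (Matrix.rank_mul_le_right _ _).trans_lt (lt_of_lt_of_le ?_ hr)
    refine Submodule.finrank_lt_finrank_of_lt (lt_of_le_of_ne ?_ fun h => ?_)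
    · rw [Matrix.mulVecLin_mul]
      exact LinearMap.range_comp_le_range _ _
    · have h1 : (y * v).mulVecLin 1 ∈ LinearMap.range (y * t).mulVecLin := by
        rw [h, Matrix.mulVecLin_mul]
        exact ⟨_, rfl⟩
      obtain ⟨x, hx⟩ := h1
      have h2 := congrArg (β.mulVecLin) hx
      rw [← LinearMap.comp_apply, ← LinearMap.comp_apply, ← Matrix.mulVecLin_mul,
        ← Matrix.mulVecLin_mul, hβyv] at h2
      have h3 : β * (y * t) = 0 := by
        rw [ht, Matrix.mul_sub, Matrix.mul_one, Matrix.mul_sub, ← Matrix.mul_assoc y,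
          ← Matrix.mul_assoc β (y * v), hβyv, Matrix.one_mul, sub_self]
      rw [h3] at h2
      have h4 := congrFun h2 0
      simp at h4
  -- shifting `b` replaces `y` by `y t`
  have key : ∀ A : Matrix (Fin r) (Fin r) F, ∀ a : k,
      conv (U.avg (Finsupp.single A a)) (Finsupp.single y 1)
        = ((Fintype.card {b : Matrix (Fin r) (Fin n) F // b * U.matrix = 0} : k)⁻¹) •
          ∑ b : {b : Matrix (Fin r) (Fin n) F // b * U.matrix = 0},
            Finsupp.lmapDomain k k (fun w => U.matrix * (w + b.1 * y))
              (conv (Finsupp.single A a) (Finsupp.single (U.retract * (y * t)) 1)) := by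
    intro A a
    rw [Grass.avg, LinearMap.smul_apply, LinearMap.sum_apply, map_smul, LinearMap.smul_apply,
      map_sum, LinearMap.sum_apply]
    congr 1
    have hs : A * U.retract * (y * v) * β * U.matrix = 0 := by
      rw [Matrix.mul_assoc _ β, hβU, Matrix.mul_zero]
    let shift : {b : Matrix (Fin r) (Fin n) F // b * U.matrix = 0} ≃
        {b : Matrix (Fin r) (Fin n) F // b * U.matrix = 0} :=
      { toFun := fun b => ⟨b.1 + A * U.retract * (y * v) * β, by
          rw [Matrix.add_mul, b.2, hs, zero_add]⟩
        invFun := fun b => ⟨b.1 - A * U.retract * (y * v) * β, by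
          rw [Matrix.sub_mul, b.2, hs, sub_zero]⟩
        left_inv := fun b => by simp
        right_inv := fun b => by simp }
    refine Fintype.sum_equiv shift _ _ fun b => ?_
    · simp only [shift, Equiv.coe_fn_mk, Finsupp.lmapDomain_apply, Finsupp.mapDomain_single,
        conv_single_single, mul_one]
      congr 1
      rw [Matrix.mul_assoc]
      congr 1
      simp only [ht, Matrix.add_mul, Matrix.mul_sub, Matrix.mul_one, Matrix.mul_assoc]
      abel
  have : ∀ c : Matrix (Fin r) (Fin r) F →₀ k, conv (U.avg c) (Finsupp.single y 1)
        = ((Fintype.card {b : Matrix (Fin r) (Fin n) F // b * U.matrix = 0} : k)⁻¹) •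
          ∑ b : {b : Matrix (Fin r) (Fin n) F // b * U.matrix = 0},
            Finsupp.lmapDomain k k (fun w => U.matrix * (w + b.1 * y))
              (conv c (Finsupp.single (U.retract * (y * t)) 1)) := by
    intro c
    induction c using Finsupp.induction_linear with
    | zero => simp
    | add f g hf hg => simp only [map_add, LinearMap.add_apply, hf, hg, Finset.sum_add_distrib,
        smul_add]
    | single A a => exact key A a
  rw [this, hc _ hyt]
  simp

/-- Kovács' theorem: the span of the matrices of rank less than `r` has a left identity. -/
theorem exists_left_identity [CharZero k] [Finite F] (r n : ℕ) :
    ∃ η ∈ lowRank k F n n r, ∀ (m : ℕ) (y : Matrix (Fin n) (Fin m) F), y.rank < r →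
      conv η (Finsupp.single y 1) = Finsupp.single y (1 : k) := by
  classical
  have := Fintype.ofFinite F
  induction r generalizing n with
  | zero => exact ⟨0, zero_mem _, fun m y hy => absurd hy (Nat.not_lt_zero _)⟩
  | succ r ih =>
    obtain ⟨η₀, h₀, hid₀⟩ := ih r
    obtain ⟨η, hη, hid⟩ := ih n
    have := Fintype.ofFinite (Grass F n r)
    -- The complement of the identity for singular `r × r` matrices: it kills rank less than `r`,
    -- and is congruent to `[1]` modulo singular matrices.
    set c : Matrix (Fin r) (Fin r) F →₀ k := Finsupp.single 1 1 - η₀ with hc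
    have hc1 : ∀ (m : ℕ) (g : Matrix (Fin r) (Fin m) F), conv c (Finsupp.single g (1 : k))
        = Finsupp.single g 1 - conv η₀ (Finsupp.single g 1) := by
      intro m g
      rw [hc, map_sub, LinearMap.sub_apply, single_one_conv]
    have hc0 : ∀ (m : ℕ) (g : Matrix (Fin r) (Fin m) F), g.rank < r →
        conv c (Finsupp.single g (1 : k)) = 0 := by
      intro m g hg
      rw [hc1, hid₀ m g hg, sub_self]
    set e : Matrix (Fin n) (Fin n) F →₀ k := ∑ U : Grass F n r, U.avg c with he
    have hemem : e ∈ lowRank k F n n (r + 1) := Submodule.sum_mem _ fun U _ => U.avg_mem_lowRank c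
    -- `e` acts as the identity up to lower rank. It kills matrices of rank less than `r`; on one of
    -- rank `r`, only the summand of its own column space survives, and this returns `[y]` up to
    -- lower rank.
    have hey : ∀ (m : ℕ) (y : Matrix (Fin n) (Fin m) F), y.rank < r + 1 →
        Finsupp.single y 1 - conv e (Finsupp.single y 1) ∈ lowRank k F n m r := by
      intro m y hy
      rw [he, map_sum, LinearMap.sum_apply]
      rcases (Nat.lt_succ_iff.1 hy).lt_or_eq with hlt | heq
      · rw [Finset.sum_eq_zero, sub_zero]
        · exact single_mem_lowRank hlt _
        intro U _
        by_cases hU : y = U.matrix * (U.retract * y)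
        · rw [hU, Grass.avg_conv_matrix_mul, hc0 _ _ ((Matrix.rank_mul_le_right _ _).trans_lt hlt),
            map_zero]
        · exact U.avg_conv_eq_zero c (hc0 m) y hlt.le hU
      · rw [Finset.sum_eq_single (columnSpace y heq)]
        · have hU := columnSpace_factor y heq
          generalize columnSpace y heq = U at hU ⊢
          have h1 : Finsupp.single y (1 : k) = conv (Finsupp.single U.matrix 1)
              (Finsupp.single (U.retract * y) 1) := by
            rw [conv_single_single, ← hU, one_mul]
          have h2 : conv (U.avg c) (Finsupp.single y (1 : k)) = conv (Finsupp.single U.matrix 1)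
              (conv c (Finsupp.single (U.retract * y) 1)) := by
            rw [← Grass.avg_conv_matrix_mul, ← hU]
          rw [h2, h1, hc1, ← map_sub, sub_sub_cancel]
          exact conv_mem_lowRank_right _ (conv_mem_lowRank_left h₀ _)
        · intro U _ hU
          exact U.avg_conv_eq_zero c (hc0 m) y heq.le fun h => hU (U.eq_columnSpace y heq h)
        · simp
    -- The complement of this element is `(1 - η)(1 - e)`: the factor `1 - e` lowers the rank below
    -- `r`, and `1 - η` then kills.
    refine ⟨η + e - conv η e, sub_mem (add_mem (lowRank_mono r.le_succ hη) hemem)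
      (conv_mem_lowRank_right _ hemem), fun m y hy => ?_⟩
    have hfix : ∀ u ∈ lowRank k F n m r, conv η u = u := by
      intro u hu
      induction hu using lowRank_induction with
      | zero => simp
      | add u v _ _ hu hv => simp [hu, hv]
      | single x a hx =>
        rw [← mul_one a, ← smul_eq_mul, ← Finsupp.smul_single, map_smul, hid m x hx]
    have h1 := hfix _ (hey m y hy)
    rw [map_sub, sub_eq_iff_eq_add] at h1
    rw [map_sub, map_add, LinearMap.sub_apply, LinearMap.add_apply, conv_assoc, h1]
    abel

end Kovacs

/-! ## A matrix is similar to its transpose -/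

section Transpose

open Polynomial

variable {F : Type*} [Field F]

/-- A bilinear form on the `F`-space underlying an `F[X]`-module, nondegenerate on the left, for
which the polynomials act by self-adjoint operators. -/
structure SelfAdjointForm (F M : Type*) [Field F] [AddCommGroup M] [Module F[X] M] where
  /-- the form -/
  form : M →+ M →+ F
  smul_left : ∀ (p : F[X]) (x y : M), form (p • x) y = form x (p • y)
  C_smul : ∀ (a : F) (x y : M), form (C a • x) y = a * form x y
  nondegenerate : ∀ x : M, (∀ y, form x y = 0) → x = 0

/-- Transport of a form along an isomorphism. -/
def SelfAdjointForm.congr {M N : Type*} [AddCommGroup M] [Module F[X] M] [AddCommGroup N]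
    [Module F[X] N] (B : SelfAdjointForm F N) (e : M ≃ₗ[F[X]] N) : SelfAdjointForm F M where
  form := (B.form.compl₂ e.toLinearMap.toAddMonoidHom).comp e.toLinearMap.toAddMonoidHom
  smul_left p x y := by simpa using B.smul_left p (e x) (e y)
  C_smul a x y := by simpa using B.C_smul a (e x) (e y)
  nondegenerate x h := by
    have := B.nondegenerate (e x) fun y => by simpa using h (e.symm y)
    simpa using this

/-- The orthogonal sum of forms. -/
def SelfAdjointForm.pi {ι : Type*} [Fintype ι] {M : ι → Type*} [∀ i, AddCommGroup (M i)]
    [∀ i, Module F[X] (M i)] (B : ∀ i, SelfAdjointForm F (M i)) :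
    SelfAdjointForm F (∀ i, M i) where
  form := ∑ i, ((B i).form.compl₂ (Pi.evalAddMonoidHom M i)).comp (Pi.evalAddMonoidHom M i)
  smul_left p x y := by simp [(B _).smul_left]
  C_smul a x y := by simp [(B _).C_smul, Finset.mul_sum]
  nondegenerate x h := by
    classical
    funext i
    refine (B i).nondegenerate (x i) fun y => ?_
    have := h (Pi.single i y)
    simp only [AddMonoidHom.finsetSum_apply, AddMonoidHom.comp_apply, AddMonoidHom.compl₂_apply,
      Pi.evalAddMonoidHom_apply] at this
    rwa [Finset.sum_eq_single i (fun j _ hj => by rw [Pi.single_eq_of_ne hj, map_zero])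
      (by simp), Pi.single_eq_same] at this

/-- The ring `F[X] / (f)` as an `F[X]`-module. -/
instance adjoinRootModule (f : F[X]) : Module F[X] (AdjoinRoot f) :=
  Module.compHom _ (AdjoinRoot.mk f)

theorem adjoinRoot_smul (f p : F[X]) (x : AdjoinRoot f) : p • x = AdjoinRoot.mk f p * x := rfl

/-- The trace form attached to the top coefficient on the cyclic module `F[X] / (f)`. -/
def SelfAdjointForm.adjoinRoot (f : F[X]) (hf : f.Monic) : SelfAdjointForm F (AdjoinRoot f) where
  form := AddMonoidHom.mul.compr₂
    ((lcoeff F (f.natDegree - 1)) ∘ₗ AdjoinRoot.modByMonicHom hf).toAddMonoidHom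
  smul_left p x y := by
    rw [adjoinRoot_smul, adjoinRoot_smul]
    simp [mul_assoc, mul_left_comm]
  C_smul a x y := by
    have : (C a : F[X]) • x = a • x := by
      rw [Algebra.smul_def]; rfl
    simp [this]
  nondegenerate x h := by
    obtain ⟨g, rfl, hg⟩ : ∃ g, AdjoinRoot.mk f g = x ∧ g.degree < f.degree := by
      obtain ⟨g, rfl⟩ := AdjoinRoot.mk_surjective x
      refine ⟨g %ₘ f, ?_, degree_modByMonic_lt g hf⟩
      rw [← AdjoinRoot.modByMonicHom_mk hf, AdjoinRoot.mk_leftInverse hf]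
    by_contra hne
    have hg0 : g ≠ 0 := by rintro rfl; simp at hne
    have hlt : g.natDegree < f.natDegree := natDegree_lt_natDegree hg0 hg
    -- This power moves the leading coefficient of `g` to degree `deg f - 1`, the one that the form
    -- reads, with no reduction modulo `f`.
    have := h (AdjoinRoot.mk f (X ^ (f.natDegree - 1 - g.natDegree)))
    simp only [AddMonoidHom.compr₂_apply, AddMonoidHom.mul_apply, LinearMap.toAddMonoidHom_coe,
      LinearMap.comp_apply, lcoeff_apply, ← map_mul, AdjoinRoot.modByMonicHom_mk] at this
    have hlt' : (g * X ^ (f.natDegree - 1 - g.natDegree)).degree < f.degree := by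
      rw [degree_mul, degree_X_pow, degree_eq_natDegree hg0, degree_eq_natDegree hf.ne_zero]
      norm_cast
      omega
    rw [(modByMonic_eq_self_iff hf).2 hlt',
      show f.natDegree - 1 = g.natDegree + (f.natDegree - 1 - g.natDegree) by omega,
      coeff_mul_X_pow', if_pos (by omega)] at this
    simp [hg0] at this

/-- By the structure theorem over the principal ideal domain `F[X]`, `M` is a finite sum of cyclic
modules, and each of these carries the top-coefficient form. -/
theorem exists_selfAdjointForm {F : Type*} [Field F] (M : Type*) [AddCommGroup M] [Module F[X] M]
    [Module.Finite F[X] M] (h : Module.IsTorsion F[X] M) : Nonempty (SelfAdjointForm F M) := by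
  classical
  obtain ⟨ι, _, p, hp, e, ⟨φ⟩⟩ := Module.equiv_directSum_of_isTorsion h
  have key : ∀ i, Nonempty (SelfAdjointForm F (F[X] ⧸ (F[X] ∙ p i ^ e i))) := by
    intro i
    have hne : p i ^ e i ≠ 0 := pow_ne_zero _ (hp i).ne_zero
    -- The generator is made monic, as reduction modulo it requires.
    have hspan : (F[X] ∙ p i ^ e i) = Ideal.span {p i ^ e i * C (p i ^ e i).leadingCoeff⁻¹} := by
      refine Ideal.span_singleton_eq_span_singleton.2 ?_
      refine associated_mul_unit_right _ _ (isUnit_C.2 ?_)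
      exact (inv_ne_zero (leadingCoeff_ne_zero.2 hne)).isUnit
    let id : (F[X] ⧸ Ideal.span {p i ^ e i * C (p i ^ e i).leadingCoeff⁻¹}) ≃ₗ[F[X]]
        AdjoinRoot (p i ^ e i * C (p i ^ e i).leadingCoeff⁻¹) :=
      { AddEquiv.refl _ with
        map_smul' := fun a x => by
          obtain ⟨x, rfl⟩ := Ideal.Quotient.mk_surjective x
          rfl }
    exact ⟨(SelfAdjointForm.adjoinRoot _ (monic_mul_leadingCoeff_inv hne)).congr
      ((Submodule.quotEquivOfEq _ _ hspan).trans id)⟩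
  exact ⟨(SelfAdjointForm.pi fun i => (key i).some).congr
    (φ.trans (DirectSum.linearEquivFunOnFintype F[X] ι _))⟩

/-- Let `X` act on `F^r` by `A`. The Gram matrix `S` of a nondegenerate form for which `X` is
self-adjoint is invertible, and self-adjointness is exactly the relation sought. -/
theorem exists_mul_eq_transpose_mul {r : ℕ} (A : Matrix (Fin r) (Fin r) F) :
    ∃ S : GL (Fin r) F, (S : Matrix (Fin r) (Fin r) F) * A = A.transpose * S := by
  obtain ⟨B⟩ := exists_selfAdjointForm (F := F) (Module.AEval' (Matrix.toLin' A))
    (Module.AEval.isTorsion_of_finiteDimensional _ _ _)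
  let of := Module.AEval'.of (Matrix.toLin' A)
  let β : (Fin r → F) →ₗ[F] (Fin r → F) →ₗ[F] F := LinearMap.mk₂ F (fun x y => B.form (of x) (of y))
    (fun x x' y => by simp) (fun c x y => by
      rw [map_smul, ← Module.AEval.C_smul, B.C_smul, smul_eq_mul])
    (fun x y y' => by simp) (fun c x y => by
      rw [map_smul, ← Module.AEval.C_smul, ← B.smul_left, B.C_smul, smul_eq_mul])
  have hβ : ∀ x y, β (A.mulVec x) y = β x (A.mulVec y) := by
    intro x y
    have := B.smul_left X (of x) (of y)
    rwa [Module.AEval'.X_smul_of, Module.AEval'.X_smul_of] at this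
  let S := LinearMap.toMatrix₂' F β
  have hS : ∀ x y, β x y = x ⬝ᵥ S.mulVec y := by
    intro x y
    rw [← Matrix.toLinearMap₂'_toMatrix' (R := F) β, Matrix.toLinearMap₂'_apply']
  have hdet : IsUnit S := by
    rw [← Matrix.isUnit_transpose, ← Matrix.mulVec_injective_iff_isUnit]
    intro x x' hxx
    rw [← sub_eq_zero]
    have h0 : S.transpose.mulVec (x - x') = 0 := by rw [Matrix.mulVec_sub, hxx, sub_self]
    have : of (x - x') = 0 := by
      refine B.nondegenerate _ fun y => ?_
      have h1 : B.form (of (x - x')) y = β (x - x') (of.symm y) := by simp [β]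
      rw [h1, hS, Matrix.dotProduct_mulVec, ← Matrix.mulVec_transpose, h0, zero_dotProduct]
    exact of.map_eq_zero_iff.1 this
  refine ⟨hdet.unit, ?_⟩
  rw [IsUnit.unit_spec]
  ext i j
  have h := hβ (Pi.single i 1) (Pi.single j 1)
  rw [hS, hS] at h
  have h2 := h.symm
  rw [Matrix.mulVec_mulVec, ← Matrix.vecMul_transpose A, ← Matrix.dotProduct_mulVec,
    Matrix.mulVec_mulVec] at h2
  simpa using h2

/-- The transpose of an invertible matrix. -/
def glTranspose {r : ℕ} (g : GL (Fin r) F) : GL (Fin r) F where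
  val := (g : Matrix (Fin r) (Fin r) F).transpose
  inv := ((g⁻¹ : GL (Fin r) F) : Matrix (Fin r) (Fin r) F).transpose
  val_inv := by rw [← Matrix.transpose_mul, ← Units.val_mul]; simp
  inv_val := by rw [← Matrix.transpose_mul, ← Units.val_mul]; simp

theorem glTranspose_mul {r : ℕ} (g h : GL (Fin r) F) :
    glTranspose (g * h) = glTranspose h * glTranspose g :=
  Units.ext (by simp [glTranspose])

theorem glTranspose_one {r : ℕ} : glTranspose (1 : GL (Fin r) F) = 1 :=
  Units.ext (by simp [glTranspose])

theorem glTranspose_glTranspose {r : ℕ} (g : GL (Fin r) F) : glTranspose (glTranspose g) = g :=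
  Units.ext (by simp [glTranspose])

theorem exists_conj_eq_glTranspose {r : ℕ} (g : GL (Fin r) F) :
    ∃ s : GL (Fin r) F, s * g * s⁻¹ = glTranspose g := by
  obtain ⟨s, hs⟩ := exists_mul_eq_transpose_mul (g : Matrix (Fin r) (Fin r) F)
  refine ⟨s, ?_⟩
  rw [mul_inv_eq_iff_eq_mul]
  exact Units.ext hs

end Transpose

/-! ## Matrix coefficients of the irreducible representations of a finite group -/

section PeterWeyl

theorem isIrreducible_iff {k G V : Type*} [Field k] [Group G] [AddCommGroup V] [Module k V]
    (ρ : Representation k G V) :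
    ρ.IsIrreducible ↔ Nontrivial V ∧ ∀ W : Submodule k V, (∀ g, ∀ x ∈ W, ρ g x ∈ W) →
      W = ⊥ ∨ W = ⊤ := by
  constructor
  · intro h
    have hnt : (⊥ : Subrepresentation ρ) ≠ ⊤ := bot_ne_top
    refine ⟨?_, fun W hW => ?_⟩
    · by_contra hV
      rw [not_nontrivial_iff_subsingleton] at hV
      exact hnt (Subrepresentation.toSubmodule_injective (Subsingleton.elim _ _))
    · rcases eq_bot_or_eq_top (⟨W, fun g x hx => hW g x hx⟩ : Subrepresentation ρ) with h | h
      · exact Or.inl (congrArg Subrepresentation.toSubmodule h)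
      · exact Or.inr (congrArg Subrepresentation.toSubmodule h)
  · rintro ⟨hV, h⟩
    refine { exists_pair_ne := ⟨⊥, ⊤, fun e => ?_⟩, eq_bot_or_eq_top := fun W => ?_ }
    · exact bot_ne_top (α := Submodule k V) (congrArg Subrepresentation.toSubmodule e)
    · refine (h W.toSubmodule fun g x hx => W.apply_mem_toSubmodule g hx).imp ?_ ?_
      · exact fun e => Subrepresentation.toSubmodule_injective e
      · exact fun e => Subrepresentation.toSubmodule_injective e

variable {k G V W : Type*} [Field k] [Group G] [AddCommGroup V] [Module k V]
  [AddCommGroup W] [Module k W]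

/-- The span of the finite orbit of a nonzero vector is invariant, hence everything. -/
theorem finiteDimensional_of_isIrreducible [Finite G] (ρ : Representation k G V)
    (h : ρ.IsIrreducible) : FiniteDimensional k V := by
  obtain ⟨hV, h⟩ := (isIrreducible_iff ρ).1 h
  obtain ⟨x, hx⟩ := exists_ne (0 : V)
  have hinv : ∀ g, ∀ y ∈ Submodule.span k (Set.range fun g => ρ g x),
      ρ g y ∈ Submodule.span k (Set.range fun g => ρ g x) := by
    intro g y hy
    have := Submodule.mem_map_of_mem (f := ρ g) hy
    rw [Submodule.map_span] at this
    refine Submodule.span_mono ?_ this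
    rintro _ ⟨_, ⟨h, rfl⟩, rfl⟩
    exact ⟨g * h, by simp⟩
  rcases h _ hinv with h | h
  · exact absurd (Submodule.span_eq_bot.1 h x ⟨1, by simp⟩) hx
  · exact ⟨h ▸ Submodule.fg_span (Set.finite_range _)⟩

section Schur

variable [Fintype G] (ρ : Representation k G V) (σ : Representation k G W)

/-- The average of the operator `x ↦ φ x • y` is an intertwining map. -/
def rankOneAverage (φ : Module.Dual k V) (y : W) : ρ.IntertwiningMap σ where
  toLinearMap := ∑ g : G, (σ g) ∘ₗ (φ.smulRight y) ∘ₗ (ρ g⁻¹)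
  isIntertwining' h := by
    ext x
    simp only [LinearMap.comp_apply, LinearMap.sum_apply, LinearMap.smulRight_apply, map_sum]
    refine Fintype.sum_equiv (Equiv.mulLeft h⁻¹) _ _ fun g => ?_
    simp [← Module.End.mul_apply, ← map_mul]

theorem rankOneAverage_apply (φ : Module.Dual k V) (y : W) (x : V) :
    rankOneAverage ρ σ φ y x = ∑ g : G, φ (ρ g⁻¹ x) • σ g y := by
  change (∑ g : G, (σ g) ∘ₗ (φ.smulRight y) ∘ₗ (ρ g⁻¹)) x = _
  simp

theorem sum_coeff_smul_of_isEmpty (hρ : ρ.IsIrreducible) (hσ : σ.IsIrreducible)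
    (h : IsEmpty (ρ.Equiv σ)) (φ : Module.Dual k V) (y : W) (x : V) :
    ∑ g : G, φ (ρ g⁻¹ x) • σ g y = 0 := by
  rw [← rankOneAverage_apply, Subsingleton.elim (rankOneAverage ρ σ φ y) 0]
  rfl

/-- By Schur's lemma the averaged rank-one operator is a scalar. Its trace is `|G| φ(y)`, since each
of the `|G|` conjugates has trace `φ(y)`, and this determines the scalar. -/
theorem sum_coeff_smul_self [IsAlgClosed k] [CharZero k] (hρ : ρ.IsIrreducible)
    (φ : Module.Dual k V) (y x : V) :
    (Module.finrank k V : k) • ∑ g : G, φ (ρ g⁻¹ x) • ρ g y = ((Fintype.card G : k) * φ y) • x := by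
  have := finiteDimensional_of_isIrreducible ρ hρ
  obtain ⟨c, hc⟩ := (Representation.IsIrreducible.algebraMap_intertwiningMap_bijective_of_isAlgClosed
    (ρ := ρ)).2 (rankOneAverage ρ ρ φ y)
  have hlin : (rankOneAverage ρ ρ φ y).toLinearMap = c • LinearMap.id := by
    rw [← hc]; rfl
  have htr := congrArg (LinearMap.trace k V) hlin
  have htr2 : LinearMap.trace k V (rankOneAverage ρ ρ φ y).toLinearMap
      = (Fintype.card G : k) * φ y := by
    change LinearMap.trace k V (∑ g : G, (ρ g) ∘ₗ (φ.smulRight y) ∘ₗ (ρ g⁻¹)) = _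
    rw [map_sum, Finset.sum_congr rfl (g := fun _ => φ y), Finset.sum_const, Finset.card_univ,
      nsmul_eq_mul]
    intro g _
    rw [LinearMap.trace_comp_comm', LinearMap.comp_assoc]
    rw [show ρ g⁻¹ ∘ₗ ρ g = LinearMap.id by
      rw [← Module.End.mul_eq_comp, ← map_mul, inv_mul_cancel, map_one]; rfl]
    rw [LinearMap.comp_id, LinearMap.trace_smulRight]
  rw [htr2, map_smul, LinearMap.trace_id, smul_eq_mul] at htr
  rw [← rankOneAverage_apply, ← Representation.IntertwiningMap.toLinearMap_apply, hlin, htr,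
    LinearMap.smul_apply, LinearMap.id_apply, smul_smul, mul_comm]

end Schur

/-- The matrix coefficients of a representation, for a map `e` from its space to the dual. -/
def coeffMap (ρ : Representation k G V) (e : V →ₗ[k] Module.Dual k V) : V ⊗[k] V →ₗ[k] (G → k) :=
  LinearMap.pi fun g => TensorProduct.lift (LinearMap.flip e ∘ₗ ρ g⁻¹)

theorem coeffMap_tmul (ρ : Representation k G V) (e : V →ₗ[k] Module.Dual k V) (x y : V) (g : G) :
    coeffMap ρ e (x ⊗ₜ y) g = e y (ρ g⁻¹ x) := rfl

/-- Through `e`, a tensor is an operator on `V`, and the hypothesis says that all the numbers `φ(T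
x)` vanish. -/
theorem tensor_eq_zero_of_forall [FiniteDimensional k V] (e : V ≃ₗ[k] Module.Dual k V)
    (t : V ⊗[k] V)
    (h : ∀ (φ : Module.Dual k V) (x : V),
      LinearMap.mul' k k (TensorProduct.map φ (e.toLinearMap.flip x) t) = 0) : t = 0 := by
  let T : V ⊗[k] V ≃ₗ[k] (V →ₗ[k] V) := (LinearEquiv.lTensor V e) ≪≫ₗ
    (TensorProduct.comm k V (Module.Dual k V)) ≪≫ₗ dualTensorHomEquiv (R := k) (M := V) (N := V)
  have hT : ∀ (φ : Module.Dual k V) (x : V) (t : V ⊗[k] V),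
      φ (T t x) = LinearMap.mul' k k (TensorProduct.map φ (e.toLinearMap.flip x) t) := by
    intro φ x t
    induction t using TensorProduct.induction_on with
    | zero => simp
    | add a b ha hb => simp [ha, hb]
    | tmul a b => simp [T, mul_comm]
  refine T.map_eq_zero_iff.1 (LinearMap.ext fun x => ?_)
  refine (Module.forall_dual_apply_eq_zero_iff k _).1 fun φ => ?_
  rw [hT, h]

section Basis

variable [Fintype G] [CharZero k] {ι : Type*} {V : ι → Type*} [∀ i, AddCommGroup (V i)]
  [∀ i, Module k (V i)] (ρ : ∀ i, Representation k G (V i))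
  (e : ∀ i, V i ≃ₗ[k] Module.Dual k (V i))

-- Schur orthogonality: summing against a coefficient of `ρ i` annihilates the other components and
-- returns a nonzero multiple of a coordinate of the `i`-th one.
open Classical in
theorem coeffMap_injective [IsAlgClosed k] (hirr : ∀ i, (ρ i).IsIrreducible)
    (hne : ∀ i j, Nonempty ((ρ i).Equiv (ρ j)) → i = j) :
    Function.Injective (DirectSum.toModule k ι (G → k) fun i => coeffMap (ρ i) (e i).toLinearMap) := by
  rw [← LinearMap.ker_eq_bot, LinearMap.ker_eq_bot']
  intro t ht
  refine DFinsupp.ext fun i => ?_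
  have := finiteDimensional_of_isIrreducible (ρ i) (hirr i)
  obtain ⟨hV, -⟩ := (isIrreducible_iff (ρ i)).1 (hirr i)
  refine tensor_eq_zero_of_forall (e i) (t i) fun φ x => ?_
  -- Evaluation is at `g⁻¹` because coefficients are defined with `ρ g⁻¹`; the two inverses cancel
  -- and leave the sum in Schur's relations.
  let test : (G → k) →ₗ[k] k := ∑ g : G, φ (ρ i g⁻¹ x) • LinearMap.proj g⁻¹
  have htest : (Module.finrank k (V i) : k) •
      (test ∘ₗ DirectSum.toModule k ι (G → k) fun i => coeffMap (ρ i) (e i).toLinearMap)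
      = (Fintype.card G : k) •
        (LinearMap.mul' k k ∘ₗ TensorProduct.map φ ((e i).toLinearMap.flip x)) ∘ₗ
          DirectSum.component k ι (fun i => V i ⊗[k] V i) i := by
    refine DirectSum.linearMap_ext k fun j => TensorProduct.ext' fun a b => ?_
    have h2 : test (coeffMap (ρ j) (e j).toLinearMap (a ⊗ₜ b))
        = e j b (∑ g : G, φ (ρ i g⁻¹ x) • ρ j g a) := by
      simp [test, coeffMap_tmul]
    simp only [LinearMap.smul_apply, LinearMap.comp_apply, DirectSum.toModule_lof, h2]
    by_cases hij : j = i
    · subst hij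
      rw [DirectSum.component.lof_self, ← map_smul, sum_coeff_smul_self (ρ j) (hirr j)]
      simp [mul_assoc]
    · rw [sum_coeff_smul_of_isEmpty (ρ i) (ρ j) (hirr i) (hirr j)
        ⟨fun f => hij (hne i j ⟨f⟩).symm⟩]
      rw [DirectSum.component.of, dif_neg hij]
      simp
  have h3 := LinearMap.congr_fun htest t
  simp only [LinearMap.smul_apply, LinearMap.comp_apply, ht, map_zero, smul_zero] at h3
  exact (smul_eq_zero.1 h3.symm).resolve_left (Nat.cast_ne_zero.2 Fintype.card_ne_zero)

end Basis

end PeterWeyl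

/-! ### Completeness of the matrix coefficients -/

section PeterWeylSurjective

variable {k : Type u} {G : Type v} [Field k] [Group G]

theorem equiv_apply {V W : Type*} [AddCommGroup V] [Module k V] [AddCommGroup W] [Module k W]
    {ρ : Representation k G V} {σ : Representation k G W} (f : ρ.Equiv σ) (g : G) (x : V) :
    f.toLinearEquiv (ρ g x) = σ g (f.toLinearEquiv x) :=
  LinearMap.congr_fun (f.isIntertwining' g) x

theorem sum_smul_eq_zero_of_equiv [Fintype G] {V W : Type*} [AddCommGroup V] [Module k V]
    [AddCommGroup W] [Module k W] {ρ : Representation k G V} {σ : Representation k G W}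
    (f : ρ.Equiv σ) (a : G → k) (h : ∑ g, a g • ρ g = 0) : ∑ g, a g • σ g = 0 := by
  ext y
  obtain ⟨x, rfl⟩ := f.toLinearEquiv.surjective y
  have h2 := congrArg f.toLinearEquiv (LinearMap.congr_fun h x)
  simpa only [LinearMap.sum_apply, LinearMap.smul_apply, map_sum, map_smul, LinearMap.zero_apply,
    map_zero, equiv_apply] using h2

/-- The spaces in `IrrRep` lie in the universe of `k`. Finite dimensionality allows a representation
in any universe to be transported to some `k^d`. -/
theorem exists_irrRep_equiv [Finite G] {V : Type*} [AddCommGroup V] [Module k V]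
    (ρ : Representation k G V) (h : ρ.IsIrreducible) :
    ∃ π : IrrRep k G, Nonempty (π.ρ.Equiv ρ) := by
  have := finiteDimensional_of_isIrreducible ρ h
  obtain ⟨hV, h⟩ := (isIrreducible_iff ρ).1 h
  let e : (Fin (Module.finrank k V) → k) ≃ₗ[k] V := LinearEquiv.ofFinrankEq _ _ (by simp)
  let σ : Representation k G (Fin (Module.finrank k V) → k) :=
    { toFun := fun g => e.symm.conj (ρ g)
      map_one' := by rw [map_one]; exact e.symm.conj_id
      map_mul' := fun a b => by rw [map_mul]; exact e.symm.conj_comp _ _ }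
  have hσ : ∀ g x, e (σ g x) = ρ g (e x) := fun g x => e.apply_symm_apply _
  refine ⟨⟨_, σ, (isIrreducible_iff σ).2 ⟨e.toEquiv.nontrivial, fun W hW => ?_⟩⟩,
    ⟨Representation.Equiv.mk e fun g => LinearMap.ext (hσ g)⟩⟩
  refine (h (W.map e.toLinearMap) ?_).imp (fun h => ?_) (fun h => ?_)
  · rintro g _ ⟨x, hx, rfl⟩
    exact ⟨_, hW g x hx, hσ g x⟩
  · refine (Submodule.eq_bot_iff _).2 fun x hx => e.map_eq_zero_iff.1 ?_
    exact (Submodule.eq_bot_iff _).1 h _ ⟨x, hx, rfl⟩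
  · refine Submodule.eq_top_iff'.2 fun x => ?_
    obtain ⟨y, hy, hxy⟩ := Submodule.eq_top_iff'.1 h (e x)
    exact e.injective hxy ▸ hy

/-- By Maschke's theorem the group algebra is a sum of simple left ideals. The element `∑ a_g g`
kills each of them, hence kills `1`. -/
theorem eq_zero_of_forall_irrRep [Fintype G] [CharZero k] (a : G → k)
    (h : ∀ π : IrrRep k G, ∑ g, a g • π.ρ g = 0) : a = 0 := by
  classical
  have hirr : ∀ {V : Type (max u v)} [AddCommGroup V] [Module k V] (ρ : Representation k G V),
      ρ.IsIrreducible → ∑ g, a g • ρ g = 0 := by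
    intro V _ _ ρ hρ
    obtain ⟨π, ⟨f⟩⟩ := exists_irrRep_equiv ρ hρ
    exact sum_smul_eq_zero_of_equiv f a (h π)
  let α : MonoidAlgebra k G := ∑ g, a g • MonoidAlgebra.of k G g
  have : NeZero (Nat.card G : k) := ⟨Nat.cast_ne_zero.2 Nat.card_pos.ne'⟩
  have hα : ∀ x : MonoidAlgebra k G, α * x = 0 := by
    intro x
    have hx : x ∈ sSup {S : Submodule (MonoidAlgebra k G) (MonoidAlgebra k G) |
        IsSimpleModule (MonoidAlgebra k G) S} := by
      rw [IsSemisimpleModule.sSup_simples_eq_top]; trivial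
    rw [sSup_eq_iSup] at hx
    induction hx using Submodule.iSup_induction' with
    | zero => simp
    | add x y _ _ hx hy => rw [mul_add, hx, hy, add_zero]
    | mem S x hx =>
      by_cases hS : IsSimpleModule (MonoidAlgebra k G) S
      swap
      · have : x = 0 := by simpa [hS] using hx
        simp [this]
      replace hx : x ∈ S := by simpa [hS] using hx
      let ρ : Representation k G S :=
        { toFun := fun g =>
            { toFun := fun y => MonoidAlgebra.of k G g • y
              map_add' := smul_add _
              map_smul' := fun c y => smul_comm _ _ _ }
          map_one' := by ext y; simp
          map_mul' := fun g g' => by ext y; simp [mul_assoc] }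
      have hρ : ρ.IsIrreducible := by
        refine (isIrreducible_iff ρ).2 ⟨IsSimpleModule.nontrivial (MonoidAlgebra k G) S,
          fun W hW => ?_⟩
        let T : Submodule (MonoidAlgebra k G) S :=
          { carrier := W
            add_mem' := W.add_mem
            zero_mem' := W.zero_mem
            smul_mem' := fun b y hy => by
              induction b using MonoidAlgebra.induction_on with
              | of g => exact hW g y hy
              | add b c hb hc => rw [add_smul]; exact W.add_mem hb hc
              | smul c b hb => rw [smul_assoc]; exact W.smul_mem c hb }
        rcases eq_bot_or_eq_top T with h | h
        · exact Or.inl (SetLike.coe_injective (congrArg SetLike.coe h :))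
        · exact Or.inr (SetLike.coe_injective (congrArg SetLike.coe h :))
      have h1 := LinearMap.congr_fun (hirr ρ hρ) ⟨x, hx⟩
      have h2 := congrArg Subtype.val h1
      rw [Finset.sum_mul]
      simp only [LinearMap.sum_apply, LinearMap.smul_apply, LinearMap.zero_apply,
        AddSubmonoidClass.coe_finsetSum, Submodule.coe_zero] at h2
      rw [← h2]
      exact Finset.sum_congr rfl fun g _ => smul_mul_assoc _ _ _
  have h1 := hα 1
  rw [mul_one] at h1
  funext g
  have h2 := congrArg (fun x : MonoidAlgebra k G => x.coeff g) h1
  simpa [α, MonoidAlgebra.coeff_sum, Finsupp.single_apply] using h2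

/-- A linear functional vanishing on all coefficients is an element of the group algebra acting by
zero in every irreducible representation, hence zero. -/
theorem coeffMap_surjective [Fintype G] [CharZero k] (rep : IrrClass k G → IrrRep k G)
    (hrep : ∀ c, (rep c).toClass = c) (e : ∀ c, (rep c).V ≃ₗ[k] Module.Dual k (rep c).V)
    [DecidableEq (IrrClass k G)] :
    Function.Surjective (DirectSum.toModule k (IrrClass k G) (G → k) fun c =>
      coeffMap (rep c).ρ (e c).toLinearMap) := by
  classical
  rw [← LinearMap.range_eq_top]
  by_contra hne
  obtain ⟨f, hf, hle⟩ := Submodule.exists_le_ker_of_lt_top _ (lt_top_iff_ne_top.2 hne)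
  let a : G → k := fun g => f (Pi.single g⁻¹ 1)
  have hfa : ∀ x : G → k, f x = ∑ g, a g * x g⁻¹ := by
    intro x
    conv_lhs => rw [← Finset.univ_sum_single x, map_sum]
    refine Fintype.sum_equiv (Equiv.inv G) _ _ fun g => ?_
    have : Pi.single (M := fun _ => k) g (x g) = x g • Pi.single g 1 := by
      rw [← Pi.single_smul, smul_eq_mul, mul_one]
    simp [a, this, mul_comm]
  have ha : a = 0 := by
    refine eq_zero_of_forall_irrRep a fun π => ?_
    have hc := hrep π.toClass
    obtain ⟨φ⟩ : Nonempty ((rep π.toClass).ρ.Equiv π.ρ) := Quotient.exact hc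
    generalize π.toClass = c at φ
    have h0 : ∑ g, a g • (rep c).ρ g = 0 := by
      ext x
      refine (Module.forall_dual_apply_eq_zero_iff k _).1 fun ψ => ?_
      obtain ⟨y, rfl⟩ := (e c).surjective ψ
      have h1 : f (coeffMap (rep c).ρ (e c).toLinearMap (x ⊗ₜ y)) = 0 := by
        refine hle ⟨DirectSum.lof k _ (fun c => (rep c).V ⊗[k] (rep c).V) c (x ⊗ₜ y), ?_⟩
        rw [DirectSum.toModule_lof]
      rw [hfa] at h1
      simpa [coeffMap_tmul] using h1
    exact sum_smul_eq_zero_of_equiv φ a h0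
  refine hf (LinearMap.ext fun x => ?_)
  rw [hfa, ha]
  simp

end PeterWeylSurjective

/-! ### Self-duality up to an anti-automorphism -/

section DualForm

variable {k G V : Type*} [Field k] [Group G] [AddCommGroup V] [Module k V]

/-- The dual of a representation, made into a representation by an anti-automorphism of the
group. -/
def twistedDual (τ : G → G) (h1 : τ 1 = 1) (hmul : ∀ g h, τ (g * h) = τ h * τ g)
    (ρ : Representation k G V) : Representation k G (Module.Dual k V) where
  toFun g := (ρ (τ g)).dualMap
  map_one' := by rw [h1, map_one]; exact LinearMap.dualMap_id
  map_mul' g h := by rw [hmul, map_mul]; exact LinearMap.dualMap_comp_dualMap _ _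

/-- The `τ`-twisted dual has character `χ(τ g)`, which is `χ(g)` because `τ g` is conjugate to `g`.
Irreducible representations with equal characters are isomorphic. -/
theorem exists_selfDual [Finite G] [IsAlgClosed k] [CharZero k] (τ : G → G) (h1 : τ 1 = 1)
    (hmul : ∀ g h, τ (g * h) = τ h * τ g) (hτ : ∀ g, τ (τ g) = g)
    (hconj : ∀ g, ∃ s, s * g * s⁻¹ = τ g) (ρ : Representation k G V) (h : ρ.IsIrreducible) :
    ∃ e : V ≃ₗ[k] Module.Dual k V, ∀ g x y, e (ρ g y) x = e y (ρ (τ g) x) := by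
  have := Fintype.ofFinite G
  have := finiteDimensional_of_isIrreducible ρ h
  let σ := twistedDual τ h1 hmul ρ
  have hσ : σ.IsIrreducible := by
    obtain ⟨hV, h⟩ := (isIrreducible_iff ρ).1 h
    refine (isIrreducible_iff σ).2 ⟨inferInstance, fun W hW => ?_⟩
    -- Annihilators exchange invariant subspaces of the dual and of `V`, hence the swap of the two
    -- alternatives.
    refine (h W.dualCoannihilator fun g x hx => ?_).symm.imp (fun h => ?_) (fun h => ?_)
    · rw [Submodule.mem_dualCoannihilator] at hx ⊢
      intro φ hφ
      have := hx _ (hW (τ g) φ hφ)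
      simpa [σ, twistedDual, hτ] using this
    · rw [← Subspace.dualCoannihilator_dualAnnihilator_eq (W := W), h,
        Submodule.dualAnnihilator_top]
    · rw [← Subspace.dualCoannihilator_dualAnnihilator_eq (W := W), h,
        Submodule.dualAnnihilator_bot]
  have hchar : ∀ g, σ.character g = ρ.character g := by
    intro g
    obtain ⟨s, hs⟩ := hconj g
    rw [← Representation.char_conj ρ g s, hs]
    exact LinearMap.trace_transpose' _
  have hcard : (Nat.card G : k) ≠ 0 := Nat.cast_ne_zero.2 Nat.card_pos.ne'
  have : Invertible (Nat.card G : k) := invertibleOfNonzero hcard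
  have e1 := Representation.char_orthonormal σ ρ
  have e2 := Representation.char_orthonormal ρ ρ
  simp only [hchar] at e1
  rw [e1, if_pos (⟨Representation.Equiv.refl ρ⟩ : Nonempty (ρ.Equiv ρ))] at e2
  obtain ⟨φ⟩ : Nonempty (ρ.Equiv σ) := by
    by_contra hne
    rw [if_neg hne] at e2
    exact zero_ne_one e2
  refine ⟨φ.toLinearEquiv, fun g x y => ?_⟩
  exact LinearMap.congr_fun (equiv_apply φ g y) x

/-- The property `he` moves `t` across the pairing as `τ t`, which cancels its inverse in the
argument. This is why both tensor factors are `ρ` itself, with no dual. -/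
theorem coeffMap_equivariant (τ : G → G) (ρ : Representation k G V)
    (e : V ≃ₗ[k] Module.Dual k V) (he : ∀ g x y, e (ρ g y) x = e y (ρ (τ g) x)) (s t g : G)
    (x : V ⊗[k] V) :
    coeffMap ρ e.toLinearMap (TensorProduct.map (ρ s) (ρ t) x) (s * g * τ t)
      = coeffMap ρ e.toLinearMap x g := by
  induction x using TensorProduct.induction_on with
  | zero => simp
  | add a b ha hb => simp [ha, hb]
  | tmul a b =>
    simp only [TensorProduct.map_tmul, coeffMap_tmul, LinearEquiv.coe_coe, he]
    simp [← Module.End.mul_apply, ← map_mul, mul_assoc]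

end DualForm

/-! ## The matrices of rank `r` -/

section RankLayer

variable {F : Type*} [Field F] {n m r : ℕ}

/-- The matrix of rank `r` with column space `U`, row space `W` and coordinate matrix `g`. -/
def rankMatrix (U : Grass F n r) (W : Grass F m r) (g : Matrix (Fin r) (Fin r) F) :
    Matrix (Fin n) (Fin m) F :=
  U.matrix * g * W.matrix.transpose

theorem retract_rankMatrix_retract (U : Grass F n r) (W : Grass F m r)
    (g : Matrix (Fin r) (Fin r) F) :
    U.retract * rankMatrix U W g * W.retract.transpose = g := by
  rw [rankMatrix, ← Matrix.mul_assoc, ← Matrix.mul_assoc, U.retract_mul_matrix, Matrix.one_mul,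
    Matrix.mul_assoc, ← Matrix.transpose_mul, W.retract_mul_matrix, Matrix.transpose_one,
    Matrix.mul_one]

theorem transpose_rankMatrix (U : Grass F n r) (W : Grass F m r) (g : Matrix (Fin r) (Fin r) F) :
    (rankMatrix U W g).transpose = rankMatrix W U g.transpose := by
  simp [rankMatrix, Matrix.transpose_mul, Matrix.mul_assoc]

theorem rankMatrix_factor (U : Grass F n r) (W : Grass F m r) (g : Matrix (Fin r) (Fin r) F) :
    rankMatrix U W g = U.matrix * (U.retract * rankMatrix U W g) := by
  rw [rankMatrix, Matrix.mul_assoc U.matrix, ← Matrix.mul_assoc U.retract, U.retract_mul_matrix,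
    Matrix.one_mul]

theorem rank_rankMatrix (U : Grass F n r) (W : Grass F m r) (g : GL (Fin r) F) :
    (rankMatrix U W g).rank = r := by
  apply le_antisymm
  · rw [rankMatrix, Matrix.mul_assoc]
    exact (Matrix.rank_mul_le_left _ _).trans (Matrix.rank_le_width _)
  · have h1 := Matrix.rank_mul_le_left (U.retract * rankMatrix U W g) W.retract.transpose
    rw [retract_rankMatrix_retract, Matrix.rank_unit, Fintype.card_fin] at h1
    exact h1.trans (Matrix.rank_mul_le_right _ _)

/-- `U` is the column space, `W` the column space of the transpose, and the retractions on both
sides recover `g`. -/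
theorem rankMatrix_injective {U U' : Grass F n r} {W W' : Grass F m r} {g g' : GL (Fin r) F}
    (h : rankMatrix U W g = rankMatrix U' W' g') : U = U' ∧ W = W' ∧ g = g' := by
  have hU : U = U' := by
    rw [U.eq_columnSpace _ (rank_rankMatrix U W g) (rankMatrix_factor U W g),
      U'.eq_columnSpace _ (rank_rankMatrix U' W' g') (rankMatrix_factor U' W' g')]
    simp only [h]
  have hW : W = W' := by
    have h' := congrArg Matrix.transpose h
    rw [transpose_rankMatrix, transpose_rankMatrix] at h'
    rw [W.eq_columnSpace _ (rank_rankMatrix W U (glTranspose g)) (rankMatrix_factor W U _),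
      W'.eq_columnSpace _ (rank_rankMatrix W' U' (glTranspose g')) (rankMatrix_factor W' U' _)]
    congr 1
  subst hU hW
  refine ⟨rfl, rfl, Units.ext ?_⟩
  rw [← retract_rankMatrix_retract U W g, h, retract_rankMatrix_retract]

theorem exists_eq_rankMatrix (x : Matrix (Fin n) (Fin m) F) (h : x.rank = r) :
    ∃ (U : Grass F n r) (W : Grass F m r) (g : GL (Fin r) F), x = rankMatrix U W g := by
  have hU := columnSpace_factor x h
  have hW := columnSpace_factor x.transpose ((Matrix.rank_transpose x).trans h)
  generalize columnSpace x h = U at hU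
  generalize columnSpace x.transpose _ = W at hW
  have hW' := congrArg Matrix.transpose hW
  rw [Matrix.transpose_transpose, Matrix.transpose_mul, Matrix.transpose_mul,
    Matrix.transpose_transpose] at hW'
  set g := U.retract * x * W.retract.transpose with hg
  have hx : x = rankMatrix U W g := by
    rw [rankMatrix, hg, ← Matrix.mul_assoc U.matrix, ← Matrix.mul_assoc U.matrix,
      Matrix.mul_assoc U.matrix U.retract, ← hU, ← hW']
  -- `x` factors through the `r × r` matrix `g`, so `g` has full rank and is invertible.
  have hrank : r ≤ g.rank := by
    have h1 := Matrix.rank_mul_le_left (U.matrix * g) W.matrix.transpose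
    have h2 := Matrix.rank_mul_le_right U.matrix g
    have h3 : (U.matrix * g * W.matrix.transpose).rank = r :=
      (congrArg Matrix.rank hx.symm).trans h
    omega
  have hunit : IsUnit g := by
    rw [← Matrix.mulVec_surjective_iff_isUnit]
    have : LinearMap.range g.mulVecLin = ⊤ := by
      apply Submodule.eq_top_of_finrank_eq
      have h1 : Module.finrank F (LinearMap.range g.mulVecLin) = g.rank := rfl
      have h2 := Matrix.rank_le_width g
      rw [h1, Module.finrank_fin_fun]
      omega
    exact LinearMap.range_eq_top.1 this
  exact ⟨U, W, hunit.unit, hx⟩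

theorem mul_grassMatrix (a : Matrix (Fin n) (Fin n) F) (U : Grass F n r)
    (h : Module.finrank F (imageOf a U.space) = r) :
    a * U.matrix = Grass.matrix ⟨imageOf a U.space, h⟩ *
      (transition a U h : Matrix (Fin r) (Fin r) F) := by
  apply Matrix.toLin'.injective
  refine LinearMap.ext fun x => ?_
  rw [Matrix.toLin'_mul, Matrix.toLin'_mul, LinearMap.comp_apply, LinearMap.comp_apply,
    Grass.toLin'_matrix, Grass.toLin'_matrix, toLin'_transition]

theorem rank_mul_grassMatrix_lt (a : Matrix (Fin n) (Fin n) F) (U : Grass F n r)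
    (h : Module.finrank F (imageOf a U.space) ≠ r) : (a * U.matrix).rank < r := by
  have h1 : (a * U.matrix).rank = Module.finrank F (imageOf a U.space) := by
    change Module.finrank F (LinearMap.range (Matrix.toLin' (a * U.matrix))) = _
    rw [Matrix.toLin'_mul, LinearMap.range_comp, U.range_toLin'_matrix]
    rfl
  have h2 := finrank_imageOf_le a U.space
  have h3 := U.finrank_eq
  omega

end RankLayer

/-! ### Matrix coefficients on the layer of rank `r` -/

section LayerMap

variable {k F : Type*} [Field k] [Field F] {n m r : ℕ} {V : Type*} [AddCommGroup V] [Module k V]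

/-- The component of an element of `L_n(ρ) ⊗ L_m(ρ)` at a pair of subspaces. -/
def pairComponent (U : Grass F n r) (W : Grass F m r) :
    (Grass F n r →₀ V) ⊗[k] (Grass F m r →₀ V) →ₗ[k] V ⊗[k] V :=
  Finsupp.lapply (U, W) ∘ₗ (finsuppTensorFinsupp k k V V (Grass F n r) (Grass F m r)).toLinearMap

theorem eq_of_pairComponent {s t : (Grass F n r →₀ V) ⊗[k] (Grass F m r →₀ V)}
    (h : ∀ U W, pairComponent U W s = pairComponent U W t) : s = t := by
  refine (finsuppTensorFinsupp k k V V (Grass F n r) (Grass F m r)).injective ?_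
  ext p
  exact h p.1 p.2

variable [Finite F]

/-- The span of the matrices of rank `r` with column space `U` and row space `W` is the space of
functions on `GL_r(F)`. -/
def cellMap (U : Grass F n r) (W : Grass F m r) :
    (GL (Fin r) F → k) →ₗ[k] (Matrix (Fin n) (Fin m) F →₀ k) :=
  Finsupp.lmapDomain k k (fun g : GL (Fin r) F => rankMatrix U W g) ∘ₗ
    (Finsupp.linearEquivFunOnFinite k k (GL (Fin r) F)).symm.toLinearMap

theorem cellMap_eq_sum [Fintype (GL (Fin r) F)] (U : Grass F n r) (W : Grass F m r)
    (f : GL (Fin r) F → k) :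
    cellMap U W f = ∑ g : GL (Fin r) F, Finsupp.single (rankMatrix U W g) (f g) := by
  classical
  conv_lhs => rw [← Finset.univ_sum_single f, map_sum]
  refine Finset.sum_congr rfl fun g _ => ?_
  simp [cellMap]

theorem cellMap_mem_lowRank (U : Grass F n r) (W : Grass F m r) (f : GL (Fin r) F → k) :
    cellMap U W f ∈ lowRank k F n m (r + 1) := by
  have := Fintype.ofFinite (GL (Fin r) F)
  rw [cellMap_eq_sum]
  exact Submodule.sum_mem _ fun g _ =>
    single_mem_lowRank ((rank_rankMatrix U W g).trans_lt r.lt_succ_self) _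

theorem cellMap_apply_self (U : Grass F n r) (W : Grass F m r) (f : GL (Fin r) F → k)
    (g : GL (Fin r) F) : cellMap U W f (rankMatrix U W g) = f g := by
  change Finsupp.mapDomain _ _ _ = _
  rw [Finsupp.mapDomain_apply fun a b h => (rankMatrix_injective h).2.2]
  rfl

theorem cellMap_apply_of_ne {U U' : Grass F n r} {W W' : Grass F m r} (h : (U', W') ≠ (U, W))
    (f : GL (Fin r) F → k) (g : GL (Fin r) F) : cellMap U' W' f (rankMatrix U W g) = 0 := by
  classical
  have := Fintype.ofFinite (GL (Fin r) F)
  rw [cellMap_eq_sum, Finsupp.finsetSum_apply]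
  refine Finset.sum_eq_zero fun g' _ => Finsupp.single_eq_of_ne fun e => h ?_
  obtain ⟨rfl, rfl, -⟩ := rankMatrix_injective e
  rfl

/-- The map from `L_n(ρ) ⊗ L_m(ρ)` to the span of the matrices of rank `r` that sends
`x u_U ⊗ y u_W` to the matrix coefficient of `x ⊗ y`, placed at the pair `(U, W)`. -/
def layerMap (n m : ℕ) (ρ : Representation k (GL (Fin r) F) V) (e : V →ₗ[k] Module.Dual k V) :
    (Grass F n r →₀ V) ⊗[k] (Grass F m r →₀ V) →ₗ[k] (Matrix (Fin n) (Fin m) F →₀ k) :=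
  Finsupp.lsum k (fun p : Grass F n r × Grass F m r => cellMap p.1 p.2 ∘ₗ coeffMap ρ e) ∘ₗ
    (finsuppTensorFinsupp k k V V (Grass F n r) (Grass F m r)).toLinearMap

variable (ρ : Representation k (GL (Fin r) F) V) (e : V →ₗ[k] Module.Dual k V)

theorem layerMap_single (U : Grass F n r) (W : Grass F m r) (x y : V) :
    layerMap n m ρ e (Finsupp.single U x ⊗ₜ Finsupp.single W y)
      = cellMap U W (coeffMap ρ e (x ⊗ₜ y)) := by
  simp [layerMap, finsuppTensorFinsupp_single]

theorem tensor_finsupp_induction {A B : Type*}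
    {motive : (A →₀ V) ⊗[k] (B →₀ V) → Prop} (zero : motive 0)
    (add : ∀ s t, motive s → motive t → motive (s + t))
    (single : ∀ (U : A) (W : B) (x y : V),
      motive (Finsupp.single U x ⊗ₜ Finsupp.single W y))
    (t : (A →₀ V) ⊗[k] (B →₀ V)) : motive t := by
  induction t using TensorProduct.induction_on with
  | zero => exact zero
  | add s t hs ht => exact add s t hs ht
  | tmul a b =>
    induction a using Finsupp.induction_linear with
    | zero => simpa using zero
    | add f g hf hg => rw [TensorProduct.add_tmul]; exact add _ _ hf hg
    | single U x =>
      induction b using Finsupp.induction_linear with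
      | zero => simpa using zero
      | add f g hf hg => rw [TensorProduct.tmul_add]; exact add _ _ hf hg
      | single W y => exact single U W x y

theorem layerMap_mem_lowRank (t : (Grass F n r →₀ V) ⊗[k] (Grass F m r →₀ V)) :
    layerMap n m ρ e t ∈ lowRank k F n m (r + 1) := by
  induction t using tensor_finsupp_induction with
  | zero => simp
  | add s t hs ht => simpa using add_mem hs ht
  | single U W x y => rw [layerMap_single]; exact cellMap_mem_lowRank _ _ _

theorem layerMap_apply (t : (Grass F n r →₀ V) ⊗[k] (Grass F m r →₀ V)) (U : Grass F n r)
    (W : Grass F m r) (g : GL (Fin r) F) :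
    layerMap n m ρ e t (rankMatrix U W g) = coeffMap ρ e (pairComponent U W t) g := by
  classical
  induction t using tensor_finsupp_induction with
  | zero => simp
  | add s t hs ht => simp [hs, ht]
  | single U' W' x y =>
    rw [layerMap_single, pairComponent, LinearMap.comp_apply, LinearEquiv.coe_coe,
      finsuppTensorFinsupp_single, Finsupp.lapply_apply]
    by_cases h : (U', W') = (U, W)
    · obtain ⟨rfl, rfl⟩ := Prod.mk.injEq .. ▸ h
      rw [cellMap_apply_self, Finsupp.single_eq_same]
    · rw [cellMap_apply_of_ne h, Finsupp.single_eq_of_ne (Ne.symm h), map_zero]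
      rfl

/-- If `a` shrinks `U` or `b` shrinks `W`, the module side is zero and the matrix side has rank less
than `r`. Otherwise the two sides agree exactly, by `coeffMap_equivariant`. -/
theorem layerMap_equivariant (e : V ≃ₗ[k] Module.Dual k V)
    (he : ∀ g x y, e (ρ g y) x = e y (ρ (glTranspose g) x))
    (a : Matrix (Fin n) (Fin n) F) (b : Matrix (Fin m) (Fin m) F)
    (t : (Grass F n r →₀ V) ⊗[k] (Grass F m r →₀ V)) :
    leftRep k F n m a (rightRep k F n m b (layerMap n m ρ e.toLinearMap t))
      - layerMap n m ρ e.toLinearMap (TensorProduct.map (simpleOp n ρ a) (simpleOp m ρ b) t)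
      ∈ lowRank k F n m r := by
  have := Fintype.ofFinite (GL (Fin r) F)
  induction t using tensor_finsupp_induction with
  | zero => simp
  | add s t hs ht => simpa [add_sub_add_comm] using add_mem hs ht
  | single U W x y =>
    have key : leftRep k F n m a (rightRep k F n m b (layerMap n m ρ e.toLinearMap
        (Finsupp.single U x ⊗ₜ Finsupp.single W y)))
        = ∑ g : GL (Fin r) F, Finsupp.single ((a * U.matrix) * (g : Matrix (Fin r) (Fin r) F) * (b * W.matrix).transpose)
          (coeffMap ρ e.toLinearMap (x ⊗ₜ y) g) := by
      rw [layerMap_single, cellMap_eq_sum, map_sum, map_sum]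
      refine Finset.sum_congr rfl fun g _ => ?_
      simp only [leftRep, rightRep, MonoidHom.coe_mk, OneHom.coe_mk, Finsupp.lmapDomain_apply,
        Finsupp.mapDomain_single, rankMatrix, Matrix.transpose_mul, Matrix.mul_assoc]
    rw [key, TensorProduct.map_tmul]
    by_cases ha : Module.finrank F (imageOf a U.space) = r
    swap
    · rw [simpleOp_single_of_ne n ρ a U ha, TensorProduct.zero_tmul, map_zero, sub_zero]
      refine Submodule.sum_mem _ fun g _ => single_mem_lowRank ?_ _
      rw [Matrix.mul_assoc]
      exact (Matrix.rank_mul_le_left _ _).trans_lt (rank_mul_grassMatrix_lt a U ha)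
    by_cases hb : Module.finrank F (imageOf b W.space) = r
    swap
    · rw [simpleOp_single_of_ne m ρ b W hb, TensorProduct.tmul_zero, map_zero, sub_zero]
      refine Submodule.sum_mem _ fun g _ => single_mem_lowRank ?_ _
      refine (Matrix.rank_mul_le_right _ _).trans_lt ?_
      rw [Matrix.rank_transpose]
      exact rank_mul_grassMatrix_lt b W hb
    rw [simpleOp_single n ρ a U ha, simpleOp_single m ρ b W hb, layerMap_single, cellMap_eq_sum,
      mul_grassMatrix a U ha, mul_grassMatrix b W hb]
    -- In the frames of `a(U)` and `b(W)`, the coordinate matrix `g` becomes `s g tᵀ`, where `s` and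
    -- `t` are the two transition matrices.
    rw [← Equiv.sum_comp ((Equiv.mulLeft (transition a U ha)).trans
      (Equiv.mulRight (glTranspose (transition b W hb)))) fun g => Finsupp.single
        (rankMatrix (⟨imageOf a U.space, ha⟩ : Grass F n r) (⟨imageOf b W.space, hb⟩ : Grass F m r)
          (g : Matrix (Fin r) (Fin r) F)) _, ← Finset.sum_sub_distrib]
    refine Submodule.sum_mem _ fun g _ => ?_
    have h1 := coeffMap_equivariant glTranspose ρ e he (transition a U ha) (transition b W hb) g
      (x ⊗ₜ y)
    have h2 : rankMatrix (⟨imageOf a U.space, ha⟩ : Grass F n r) (⟨imageOf b W.space, hb⟩ : Grass F m r)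
        ((transition a U ha * g * glTranspose (transition b W hb) : GL (Fin r) F) :
          Matrix (Fin r) (Fin r) F)
        = Grass.matrix ⟨imageOf a U.space, ha⟩ * (transition a U ha : Matrix (Fin r) (Fin r) F)
          * (g : Matrix (Fin r) (Fin r) F) * (Grass.matrix ⟨imageOf b W.space, hb⟩ *
            (transition b W hb : Matrix (Fin r) (Fin r) F)).transpose := by
      simp [rankMatrix, glTranspose, Matrix.transpose_mul, Matrix.mul_assoc]
    rw [TensorProduct.map_tmul] at h1
    simp only [Equiv.trans_apply, Equiv.coe_mulLeft, Equiv.coe_mulRight, h1, h2, sub_self]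
    exact zero_mem _

end LayerMap

/-! ## The decomposition -/

section Equivariance

variable {k F : Type*} [Field k] [Field F] {n m : ℕ}

/-- A linear map that commutes with the operators of pairs of matrices commutes with the action
of the tensor product of the monoid algebras. -/
theorem map_boxAction {V W : Type*} [AddCommGroup V] [Module k V] [AddCommGroup W] [Module k W]
    (ρ : Representation k (Matrix (Fin n) (Fin n) F) V)
    (σ : Representation k (Matrix (Fin m) (Fin m) F) W)
    (f : V ⊗[k] W →ₗ[k] (Matrix (Fin n) (Fin m) F →₀ k))
    (hf : ∀ a b t, f (TensorProduct.map (ρ a) (σ b) t)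
      = leftRep k F n m a (rightRep k F n m b (f t)))
    (z : MonoidAlgebra k (Matrix (Fin n) (Fin n) F) ⊗[k] MonoidAlgebra k (Matrix (Fin m) (Fin m) F))
    (t : V ⊗[k] W) : f (boxAction ρ σ z t) = rectAction k F n m z (f t) := by
  induction z using TensorProduct.induction_on with
  | zero => simp
  | add x y hx hy => simp [hx, hy]
  | tmul p q =>
    induction p using MonoidAlgebra.induction_on with
    | add x y hx hy => simp only [TensorProduct.add_tmul, map_add, LinearMap.add_apply, hx, hy]
    | smul c x hx =>
      simp only [← TensorProduct.smul_tmul', map_smul, LinearMap.smul_apply, hx]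
    | of a =>
      induction q using MonoidAlgebra.induction_on with
      | add x y hx hy => simp only [TensorProduct.tmul_add, map_add, LinearMap.add_apply, hx, hy]
      | smul c x hx => simp only [TensorProduct.tmul_smul, map_smul, LinearMap.smul_apply, hx]
      | of b =>
        have h1 : boxAction ρ σ (MonoidAlgebra.of k _ a ⊗ₜ MonoidAlgebra.of k _ b)
            = TensorProduct.map (ρ a) (σ b) := by
          rw [boxAction, AlgHom.comp_apply, Algebra.TensorProduct.map_tmul,
            Representation.asAlgebraHom_of, Representation.asAlgebraHom_of]
          rfl
        have h2 : rectAction k F n m (MonoidAlgebra.of k _ a ⊗ₜ MonoidAlgebra.of k _ b)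
            = leftRep k F n m a * rightRep k F n m b := by
          rw [rectAction, Algebra.TensorProduct.lift_tmul,
            Representation.asAlgebraHom_of, Representation.asAlgebraHom_of]
        rw [h1, h2, hf]
        rfl

end Equivariance

/-! ### Central idempotents splitting the rank filtration -/

section Idempotent

variable (k F : Type*) [Field k] [CharZero k] [Field F] [Finite F] (n r : ℕ)

/-- The identity element of the ideal spanned by the matrices of rank less than `r`. -/
def lowRankOne : Matrix (Fin n) (Fin n) F →₀ k :=
  (exists_left_identity (k := k) (F := F) r n).choose

theorem lowRankOne_mem : lowRankOne k F n r ∈ lowRank k F n n r :=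
  (exists_left_identity (k := k) (F := F) r n).choose_spec.1

variable {k F n r} {m : ℕ}

theorem lowRankOne_conv {u : Matrix (Fin n) (Fin m) F →₀ k} (hu : u ∈ lowRank k F n m r) :
    conv (lowRankOne k F n r) u = u := by
  induction hu using lowRank_induction with
  | zero => simp
  | add u v _ _ hu hv => simp [hu, hv]
  | single x a hx =>
    rw [← mul_one a, ← smul_eq_mul, ← Finsupp.smul_single, map_smul]
    rw [lowRankOne, (exists_left_identity (k := k) (F := F) r n).choose_spec.2 m x hx]

theorem lowRankOne_comm (u : Matrix (Fin n) (Fin n) F →₀ k) :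
    conv u (lowRankOne k F n r) = conv (lowRankOne k F n r) u := by
  induction u using Finsupp.induction_linear with
  | zero => simp
  | add f g hf hg => simp [hf, hg]
  | single a c =>
    rw [← mul_one c, ← smul_eq_mul, ← Finsupp.smul_single, map_smul, map_smul,
      LinearMap.smul_apply]
    rw [conv_comm_of_left_identity (lowRankOne_mem k F n r)
      fun y hy => lowRankOne_conv (single_mem_lowRank hy 1)]

variable (k F n r m) in
/-- Multiplication by the complementary central idempotent. -/
def highPart : Module.End k (Matrix (Fin n) (Fin m) F →₀ k) :=
  LinearMap.id - conv (lowRankOne k F n r)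

theorem highPart_apply (u : Matrix (Fin n) (Fin m) F →₀ k) :
    highPart k F n r m u = u - conv (lowRankOne k F n r) u := rfl

theorem highPart_eq_zero {u : Matrix (Fin n) (Fin m) F →₀ k} (hu : u ∈ lowRank k F n m r) :
    highPart k F n r m u = 0 := by
  rw [highPart_apply, lowRankOne_conv hu, sub_self]

theorem highPart_conv (v : Matrix (Fin n) (Fin n) F →₀ k) (u : Matrix (Fin n) (Fin m) F →₀ k) :
    highPart k F n r m (conv v u) = conv v (highPart k F n r m u) := by
  rw [highPart_apply, highPart_apply, map_sub, ← conv_assoc, ← conv_assoc, lowRankOne_comm]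

theorem highPart_leftRep_rightRep (a : Matrix (Fin n) (Fin n) F) (b : Matrix (Fin m) (Fin m) F)
    (u : Matrix (Fin n) (Fin m) F →₀ k) :
    highPart k F n r m (leftRep k F n m a (rightRep k F n m b u))
      = leftRep k F n m a (rightRep k F n m b (highPart k F n r m u)) := by
  rw [leftRep_apply, leftRep_apply, highPart_conv, rightRep_apply, rightRep_apply, highPart_apply,
    highPart_apply, map_sub conv, LinearMap.sub_apply, conv_assoc]

theorem highPart_mem_lowRank {s : ℕ} {u : Matrix (Fin n) (Fin m) F →₀ k}
    (hu : u ∈ lowRank k F n m s) : highPart k F n r m u ∈ lowRank k F n m s :=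
  sub_mem hu (conv_mem_lowRank_right _ hu)

end Idempotent

/-! ### Equivariant embeddings of the summands -/

section Decomposition

variable {k F : Type*} [Field k] [CharZero k] [Field F] [Finite F] {n m r : ℕ}
  {V : Type*} [AddCommGroup V] [Module k V]

/-- The embedding of `L_n(ρ) ⊗ L_m(ρ)` into `k[M_{n,m}]`. -/
def embed (n m : ℕ) (ρ : Representation k (GL (Fin r) F) V) (e : V →ₗ[k] Module.Dual k V) :
    (Grass F n r →₀ V) ⊗[k] (Grass F m r →₀ V) →ₗ[k] (Matrix (Fin n) (Fin m) F →₀ k) :=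
  highPart k F n r m ∘ₗ layerMap n m ρ e

theorem embed_equivariant (ρ : Representation k (GL (Fin r) F) V) (e : V ≃ₗ[k] Module.Dual k V)
    (he : ∀ g x y, e (ρ g y) x = e y (ρ (glTranspose g) x))
    (a : Matrix (Fin n) (Fin n) F) (b : Matrix (Fin m) (Fin m) F)
    (t : (Grass F n r →₀ V) ⊗[k] (Grass F m r →₀ V)) :
    embed n m ρ e.toLinearMap (TensorProduct.map (simpleRep n ρ a) (simpleRep m ρ b) t)
      = leftRep k F n m a (rightRep k F n m b (embed n m ρ e.toLinearMap t)) := by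
  have h := highPart_eq_zero (layerMap_equivariant ρ e he a b t)
  rw [map_sub, highPart_leftRep_rightRep, sub_eq_zero] at h
  exact h.symm

variable (ρ : Representation k (GL (Fin r) F) V) (e : V →ₗ[k] Module.Dual k V)

theorem embed_mem_lowRank (t : (Grass F n r →₀ V) ⊗[k] (Grass F m r →₀ V)) :
    embed n m ρ e t ∈ lowRank k F n m (r + 1) :=
  highPart_mem_lowRank (layerMap_mem_lowRank ρ e t)

/-- `η_{s+1}` is spanned by matrices of rank at most `s < r`, so its product with anything is killed
by `1 - η_r`, which can be moved to the outside because `η_r` is central. -/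
theorem conv_embed_of_lt {s : ℕ} (h : s < r) (t : (Grass F n r →₀ V) ⊗[k] (Grass F m r →₀ V)) :
    conv (lowRankOne k F n (s + 1)) (embed n m ρ e t) = 0 := by
  rw [embed, LinearMap.comp_apply, ← highPart_conv]
  exact highPart_eq_zero
    (conv_mem_lowRank_left (lowRank_mono h (lowRankOne_mem k F n (s + 1))) _)

/-- The correction by `η_r` involves only matrices of rank less than `r`, invisible at a matrix of
rank `r`. -/
theorem embed_apply (t : (Grass F n r →₀ V) ⊗[k] (Grass F m r →₀ V)) (U : Grass F n r)
    (W : Grass F m r) (g : GL (Fin r) F) :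
    embed n m ρ e t (rankMatrix U W g) = coeffMap ρ e (pairComponent U W t) g := by
  rw [embed, LinearMap.comp_apply, highPart_apply, Finsupp.sub_apply, layerMap_apply,
    apply_eq_zero_of_mem_lowRank (conv_mem_lowRank_left (lowRankOne_mem k F n r) _)
      (rank_rankMatrix U W g).ge, sub_zero]

end Decomposition

/-! ### The sum of the embeddings is bijective -/

section Total

open Classical

variable {k : Type u} {F : Type v} [Field k] [Field F]
  (n m : ℕ) (rep : ∀ r : ℕ, IrrClass k (GL (Fin r) F) → IrrRep k (GL (Fin r) F))
  (e : ∀ r c, (rep r c).V ≃ₗ[k] Module.Dual k (rep r c).V)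

/-- The pairs of a rank and a class of irreducible representations. -/
abbrev Index (k : Type u) (F : Type v) [Field k] [Field F] (n m : ℕ) :=
  Σ r : {r : ℕ // r ≤ min n m}, IrrClass k (GL (Fin r.1) F)

/-- The space of `L_n(π) ⊗ L_m(π)`. -/
abbrev Summand (n m : ℕ) (rep : ∀ r : ℕ, IrrClass k (GL (Fin r) F) → IrrRep k (GL (Fin r) F))
    (i : Index k F n m) : Type _ :=
  (Grass F n i.1.1 →₀ (rep i.1.1 i.2).V) ⊗[k] (Grass F m i.1.1 →₀ (rep i.1.1 i.2).V)

/-- The components at a rank and a pair of subspaces of an element of the sum. -/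
def totalComponent (r : {r : ℕ // r ≤ min n m}) (U : Grass F n r.1) (W : Grass F m r.1) :
    (⨁ i : Index k F n m, Summand n m rep i) →ₗ[k]
      ⨁ c : IrrClass k (GL (Fin r.1) F), (rep r.1 c).V ⊗[k] (rep r.1 c).V where
  toFun t := DFinsupp.mapRange (fun c => pairComponent U W) (fun _ => map_zero _)
    (DFinsupp.comapDomain (fun c => (⟨r, c⟩ : Index k F n m))
      (fun _ _ h => eq_of_heq (Sigma.mk.inj h).2) t)
  map_add' s t := by
    refine DFinsupp.ext fun c => ?_
    exact map_add (pairComponent U W) _ _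
  map_smul' a t := by
    refine DFinsupp.ext fun c => ?_
    exact map_smul (pairComponent U W) _ _

theorem totalComponent_apply (r : {r : ℕ // r ≤ min n m}) (U : Grass F n r.1) (W : Grass F m r.1)
    (t : ⨁ i : Index k F n m, Summand n m rep i) (c : IrrClass k (GL (Fin r.1) F)) :
    totalComponent n m rep r U W t c = pairComponent U W (t ⟨r, c⟩) := rfl

theorem totalComponent_lof (r : {r : ℕ // r ≤ min n m}) (U : Grass F n r.1) (W : Grass F m r.1)
    (c : IrrClass k (GL (Fin r.1) F)) (t : Summand n m rep ⟨r, c⟩) :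
    totalComponent n m rep r U W (DirectSum.lof k _ _ ⟨r, c⟩ t)
      = DirectSum.lof k _ (fun c => (rep r.1 c).V ⊗[k] (rep r.1 c).V) c (pairComponent U W t) := by
  refine DFinsupp.ext fun c' => ?_
  rw [totalComponent_apply]
  by_cases h : c = c'
  · subst h
    rw [DirectSum.lof_apply, DirectSum.lof_apply]
  · rw [DirectSum.lof_eq_of, DirectSum.lof_eq_of, DirectSum.of_eq_of_ne _ _ _ (Ne.symm h),
      DirectSum.of_eq_of_ne, map_zero]
    intro h'
    exact h (by simpa using h'.symm)

theorem totalComponent_lof_of_ne (r s : {r : ℕ // r ≤ min n m}) (hrs : s ≠ r) (U : Grass F n r.1)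
    (W : Grass F m r.1) (c : IrrClass k (GL (Fin s.1) F)) (t : Summand n m rep ⟨s, c⟩) :
    totalComponent n m rep r U W (DirectSum.lof k _ _ ⟨s, c⟩ t) = 0 := by
  refine DFinsupp.ext fun c' => ?_
  rw [totalComponent_apply, DirectSum.lof_eq_of, DirectSum.of_eq_of_ne, map_zero]
  · rfl
  · intro h
    exact hrs (congrArg Sigma.fst h).symm

variable [CharZero k] [Finite F]

/-- The sum of the embeddings of the modules `L_n(π) ⊗ L_m(π)`. -/
def totalMap : (⨁ i : Index k F n m, Summand n m rep i) →ₗ[k] (Matrix (Fin n) (Fin m) F →₀ k) :=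
  DirectSum.toModule k _ _ fun i => embed n m (rep i.1.1 i.2).ρ (e i.1.1 i.2).toLinearMap

theorem totalMap_lof (i : Index k F n m) (t : Summand n m rep i) :
    totalMap n m rep e (DirectSum.lof k _ _ i t)
      = embed n m (rep i.1.1 i.2).ρ (e i.1.1 i.2).toLinearMap t :=
  DirectSum.toModule_lof ..

/-- This isolates one rank: `η_{r+1}` kills the summands of larger rank and fixes those of rank `r`,
while the summands of smaller rank have no coefficient at a matrix of rank `r`. -/
theorem conv_totalMap_apply (r : {r : ℕ // r ≤ min n m}) (U : Grass F n r.1) (W : Grass F m r.1)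
    (g : GL (Fin r.1) F) (t : ⨁ i : Index k F n m, Summand n m rep i) :
    conv (lowRankOne k F n (r.1 + 1)) (totalMap n m rep e t) (rankMatrix U W g)
      = DirectSum.toModule k _ (GL (Fin r.1) F → k)
        (fun c => coeffMap (rep r.1 c).ρ (e r.1 c).toLinearMap)
        (totalComponent n m rep r U W t) g := by
  suffices Finsupp.lapply (rankMatrix U W g) ∘ₗ conv (lowRankOne k F n (r.1 + 1)) ∘ₗ
      totalMap n m rep e = LinearMap.proj g ∘ₗ DirectSum.toModule k _ (GL (Fin r.1) F → k)
        (fun c => coeffMap (rep r.1 c).ρ (e r.1 c).toLinearMap) ∘ₗ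
        totalComponent n m rep r U W from LinearMap.congr_fun this t
  refine DirectSum.linearMap_ext k fun i => LinearMap.ext fun t => ?_
  obtain ⟨s, c⟩ := i
  simp only [LinearMap.comp_apply, Finsupp.lapply_apply, LinearMap.proj_apply, totalMap_lof]
  rcases lt_trichotomy s.1 r.1 with h | h | h
  · rw [totalComponent_lof_of_ne n m rep r s (fun e => h.ne (congrArg _ e)), map_zero,
      apply_eq_zero_of_mem_lowRank (r := r.1) (conv_mem_lowRank_right _
        (lowRank_mono h (embed_mem_lowRank _ _ t))) (rank_rankMatrix U W g).ge]
    rfl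
  · obtain rfl : s = r := Subtype.ext h
    rw [totalComponent_lof, DirectSum.toModule_lof, lowRankOne_conv (embed_mem_lowRank _ _ t),
      embed_apply]
  · rw [totalComponent_lof_of_ne n m rep r s (fun e => h.ne' (congrArg _ e)), map_zero,
      conv_embed_of_lt _ _ h]
    rfl

theorem totalMap_injective [IsAlgClosed k] (hrep : ∀ r c, (rep r c).toClass = c) :
    Function.Injective (totalMap n m rep e) := by
  intro s t hst
  refine DFinsupp.ext fun ⟨r, c⟩ => eq_of_pairComponent fun U W => ?_
  have := Fintype.ofFinite (GL (Fin r.1) F)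
  have hinj := coeffMap_injective (fun c => (rep r.1 c).ρ) (e r.1) (fun c => (rep r.1 c).irreducible)
    (fun c d h => by rw [← hrep r.1 c, ← hrep r.1 d]; exact Quotient.sound h)
  have h0 : totalComponent n m rep r U W s = totalComponent n m rep r U W t := by
    refine hinj (funext fun g => ?_)
    rw [← conv_totalMap_apply, hst, conv_totalMap_apply]
  rw [← totalComponent_apply, h0, totalComponent_apply]

theorem totalMap_surjective (hrep : ∀ r c, (rep r c).toClass = c) :
    Function.Surjective (totalMap n m rep e) := by
  rw [← LinearMap.range_eq_top, eq_top_iff, ← lowRank_eq_top (Nat.lt_succ_self (min n m))]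
  suffices ∀ r ≤ min n m + 1, lowRank k F n m r ≤ LinearMap.range (totalMap n m rep e) from
    this _ le_rfl
  intro r
  induction r with
  | zero =>
    intro _ u hu
    induction hu using lowRank_induction with
    | zero => exact zero_mem _
    | add u v _ _ hu hv => exact add_mem hu hv
    | single x a hx => exact absurd hx (Nat.not_lt_zero _)
  | succ r ih =>
    intro hr u hu
    have hlow := ih (Nat.le_of_succ_le hr)
    induction hu using lowRank_induction with
    | zero => exact zero_mem _
    | add u v _ _ hu hv => exact add_mem hu hv
    | single x a hx =>
      rcases (Nat.lt_succ_iff.1 hx).lt_or_eq with hlt | heq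
      · exact hlow (single_mem_lowRank hlt a)
      have := Fintype.ofFinite (GL (Fin r) F)
      obtain ⟨U, W, g, rfl⟩ := exists_eq_rankMatrix x heq
      obtain ⟨t, ht⟩ := coeffMap_surjective (rep r) (hrep r) (e r) (Pi.single g a)
      have hcell : Finsupp.single (rankMatrix U W (g : Matrix (Fin r) (Fin r) F)) a
          = cellMap U W (Pi.single g a) := by
        rw [cellMap_eq_sum, Finset.sum_eq_single g, Pi.single_eq_same]
        · intro g' _ hg'
          rw [Pi.single_eq_of_ne hg', Finsupp.single_zero]
        · simp
      rw [hcell, ← ht]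
      -- What remains holds for every `t`, so it can be checked on pure tensors.
      clear ht hcell
      induction t using DirectSum.induction_on with
      | zero => simp
      | add s t hs ht => rw [map_add, map_add]; exact add_mem hs ht
      | of c t =>
        rw [← DirectSum.lof_eq_of k, DirectSum.toModule_lof]
        induction t using TensorProduct.induction_on with
        | zero => simp
        | add s t hs ht => rw [map_add, map_add]; exact add_mem hs ht
        | tmul x y =>
          rw [← layerMap_single]
          -- Write `z = (1 - η_r) z + η_r z`: the first term is the image of a summand, the second
          -- has lower rank and is covered by induction.
          set z := layerMap n m (rep r c).ρ (e r c).toLinearMap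
            (Finsupp.single U x ⊗ₜ Finsupp.single W y) with hz
          have h1 : highPart k F n r m z ∈ LinearMap.range (totalMap n m rep e) :=
            ⟨DirectSum.lof k _ (Summand n m rep) ⟨⟨r, Nat.le_of_succ_le_succ hr⟩, c⟩
              (Finsupp.single U x ⊗ₜ Finsupp.single W y), totalMap_lof ..⟩
          have h2 := hlow (conv_mem_lowRank_left (lowRankOne_mem k F n r) z)
          have h3 := add_mem h1 h2
          rwa [highPart_apply, sub_add_cancel] at h3

end Total

/-- The embedding of `L_n(ρ) ⊗ L_m(ρ)` as a map of modules over `k[M_n] ⊗ k[M_m]`. -/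
def embedHom {k F : Type*} [Field k] [CharZero k] [Field F] [Finite F] (n m : ℕ) {r : ℕ}
    {V : Type*} [AddCommGroup V] [Module k V] (ρ : Representation k (GL (Fin r) F) V)
    (e : V ≃ₗ[k] Module.Dual k V) (he : ∀ g x y, e (ρ g y) x = e y (ρ (glTranspose g) x)) :
    ActionModule (boxAction (simpleRep n ρ) (simpleRep m ρ)) →ₗ[MonoidAlgebra k
      (Matrix (Fin n) (Fin n) F) ⊗[k] MonoidAlgebra k (Matrix (Fin m) (Fin m) F)]
      ActionModule (rectAction k F n m) where
  toFun t := ActionModule.of _ (embed n m ρ e.toLinearMap ((ActionModule.of _).symm t))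
  map_add' s t := by rw [map_add, map_add, map_add]
  map_smul' z t := map_boxAction _ _ _ (embed_equivariant ρ e he) z t

end MatrixMonoid

end

theorem proposition6p2 {k : Type*} {F : Type*} [Field k] [IsAlgClosed k] [CharZero k]
    [Field F] [Finite F] (n m : ℕ)
    (rep : ∀ r : ℕ, MatrixMonoid.IrrClass k (GL (Fin r) F) → MatrixMonoid.IrrRep k (GL (Fin r) F))
    (hrep : ∀ (r : ℕ) (c : MatrixMonoid.IrrClass k (GL (Fin r) F)), (rep r c).toClass = c) :
    Nonempty
      (MatrixMonoid.ActionModule (MatrixMonoid.rectAction k F n m)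
        ≃ₗ[MonoidAlgebra k (Matrix (Fin n) (Fin n) F) ⊗[k]
            MonoidAlgebra k (Matrix (Fin m) (Fin m) F)]
        ⨁ i : (Σ r : {r : ℕ // r ≤ min n m}, MatrixMonoid.IrrClass k (GL (Fin r.1) F)),
          MatrixMonoid.ActionModule
            (MatrixMonoid.boxAction
              (MatrixMonoid.simpleRep n (rep i.1.1 i.2).ρ)
              (MatrixMonoid.simpleRep m (rep i.1.1 i.2).ρ))) := by
  classical
  choose e he using fun r c => MatrixMonoid.exists_selfDual (k := k) MatrixMonoid.glTranspose
    MatrixMonoid.glTranspose_one MatrixMonoid.glTranspose_mul MatrixMonoid.glTranspose_glTranspose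
    MatrixMonoid.exists_conj_eq_glTranspose (rep r c).ρ (rep r c).irreducible
  let f := DirectSum.toModule (MonoidAlgebra k (Matrix (Fin n) (Fin n) F) ⊗[k]
      MonoidAlgebra k (Matrix (Fin m) (Fin m) F)) (MatrixMonoid.Index k F n m)
    (MatrixMonoid.ActionModule (MatrixMonoid.rectAction k F n m)) fun i =>
      MatrixMonoid.embedHom n m (rep i.1.1 i.2).ρ (e i.1.1 i.2) (he i.1.1 i.2)
  -- `ActionModule` only renames the underlying space, so the map over the tensor product algebra
  -- and the `k`-linear one are the same function by definition.
  have hf : ∀ x, f x = MatrixMonoid.totalMap n m rep e x := by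
    intro x
    rfl
  have hb : Function.Bijective f := by
    refine ⟨fun s t h => ?_, fun x => ?_⟩
    · rw [hf, hf] at h
      exact MatrixMonoid.totalMap_injective n m rep e hrep h
    · obtain ⟨t, ht⟩ := MatrixMonoid.totalMap_surjective n m rep e hrep x
      exact ⟨t, (hf t).trans ht⟩
  exact ⟨(LinearEquiv.ofBijective f hb).symm⟩
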